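/- Let $m>0$ and let $M=\{(\tau,\xi)\in\mathbb R^2:\tau^2\neq 2m\}\times S^2$, with the metric $$g=-\frac{4\tau^4}{2m-\tau^2}\,d\tau^2+(2m-\tau^2)\,\tau^4\,(4\xi\,d\tau+\tau\,d\xi)^2+\tau^4\,d\sigma^2,$$ where $d\sigma^2$ is the metric of the unit sphere $S^2$. For $\tau\neq0$ this is the Schwarzschild metric $-(1-\frac{2m}{r})dt^2+(1-\frac{2m}{r})^{-1}dr^2+r^2d\sigma^2$ written in the coordinates given by $r=\tau^2$, $t=\xi\tau^4$; and $g$ is analytic on all of $M$, including the singularity $r=\tau^2=0$. Then $(M,g)$ is a quasi-regular spacetime (in any smooth atlas compatible with the coordinates $(\tau,\xi)$). Moreover, at every point where $g$ is non-degenerate, $R_{ab}=0$, $S_{abcd}=E_{abcd}=0$ and $R_{abcd}=C_{abcd}$; and $R_{abcd}$, hence also the extension of the Weyl tensor $C_{abcd}$ by $R_{abcd}$, is smooth on all of $M$. Definitions. Let $g$ be a smooth, possibly degenerate, symmetric bilinear form field on a manifold $M$ of dimension $n$. Let $\flat:T_pM\to T_p^*M$, $X^\flat=g(X,\cdot)$;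 on $\flat(T_pM)$ there is the inner product $g_\bullet(X^\flat,Y^\flat)=g(X,Y)$, and a contraction of two covariant slots, denoted by $\bullet$, is taken with it. The Koszul form is $$\mathcal K(X,Y,Z)=\tfrac12\{X\langle Y,Z\rangle+Y\langle Z,X\rangle-Z\langle X,Y\rangle-\langle X,[Y,Z]\rangle+\langle Y,[Z,X]\rangle+\langle Z,[X,Y]\rangle\}.$$ $g$ is semi-regular if, for all local smooth vector fields $X,Y,Z,T$, $\mathcal K(X,Y,\_)\in\flat(T_pM)$ at each point $p$ and $\mathcal K(X,Y,\bullet)\mathcal K(Z,T,\bullet)$ is smooth. With $\Gamma_{abc}=\mathcal K(\partial_a,\partial_b,\partial_c)$ the Riemann curvature is $$R_{abcd}=\partial_a\Gamma_{bcd}-\partial_b\Gamma_{acd}+\Gamma_{ac\bullet}\Gamma_{bd\bullet}-\Gamma_{bc\bullet}\Gamma_{ad\bullet}.$$ Where $g$ is non-degenerate, put $R_{ab}=g^{st}R_{asbt}$, $R=g^{st}R_{st}$, $S_{ab}=R_{ab}-\frac1nRg_{ab}$, $S_{abcd}=\frac{1}{2n(n-1)}R(g\circ g)_{abcd}$, $E_{abcd}=\frac1{n-2}(S\circ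 g)_{abcd}$, $C_{abcd}=R_{abcd}-S_{abcd}-E_{abcd}$, with the Kulkarni–Nomizu product $(h\circ k)_{abcd}=h_{ac}k_{bd}-h_{ad}k_{bc}+h_{bd}k_{ac}-h_{bc}k_{ad}$. A semi-regular $g$ is quasi-regular if it is non-degenerate on a dense subset of $M$ and $S_{abcd}$, $E_{abcd}$ extend smoothly from the points where $g$ is non-degenerate to all of $M$. A semi-regular spacetime is a $4$-dimensional manifold with a semi-regular metric that is non-degenerate on a dense subset and has at each point at most three positive and at most one negative directions; a quasi-regular spacetime is a semi-regular spacetime whose metric is quasi-regular. -/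

import Mathlib

open Set Module
open scoped Manifold ContDiff

noncomputable section

/-! ### Pointwise linear algebra of possibly degenerate symmetric bilinear forms -/

section Algebra

/-- A (symmetric) bilinear form is non-degenerate if its radical is trivial. -/
def IsNondegenerateForm {V : Type*} [AddCommGroup V] [Module ℝ V] [TopologicalSpace V]
    [IsTopologicalAddGroup V] [ContinuousSMul ℝ V] (B : V →L[ℝ] V →L[ℝ] ℝ) : Prop :=
  ∀ u, (∀ v, B u v = 0) → u = 0

/-- `φ ∈ ♭(V)`, where `♭ : V → V*` is `v ↦ B v`. -/
def InFlat {V : Type*} [NormedAddCommGroup V] [NormedSpace ℝ V]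
    (B : V →L[ℝ] V →L[ℝ] ℝ) (φ : V → ℝ) : Prop :=
  ∃ v, ∀ w, φ w = B v w

open Classical in
/-- The contraction between covariant slots: the inner product that the symmetric form `B` induces
on `♭(V)` by `B_•(u♭, v♭) = B u v`. For symmetric `B` it does not depend on the chosen `u`, `v`.
Outside `♭(V)` the contraction is undefined (the value `0` is a placeholder). -/
def contraction {V : Type*} [NormedAddCommGroup V] [NormedSpace ℝ V]
    (B : V →L[ℝ] V →L[ℝ] ℝ) (φ ψ : V → ℝ) : ℝ :=
  if h : InFlat B φ ∧ InFlat B ψ then B h.1.choose h.2.choose else 0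

/-- The trace `g^{st} T_{st}` of `T` with the inverse of the non-degenerate form `B`, computed in a
basis of `V` (it does not depend on the basis). -/
def inverseTrace {V : Type*} [NormedAddCommGroup V] [NormedSpace ℝ V] [FiniteDimensional ℝ V]
    (B : V →L[ℝ] V →L[ℝ] ℝ) (T : V → V → ℝ) : ℝ :=
  let b := Module.finBasis ℝ V
  ∑ s, ∑ t, (Matrix.of fun i j => B (b i) (b j))⁻¹ s t * T (b s) (b t)

/-- The Kulkarni–Nomizu product `(h ∘ k)_{abcd}`. -/
def kulkarniNomizu {V : Type*} (h k : V → V → ℝ) (a b c d : V) : ℝ :=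
  h a c * k b d - h a d * k b c + h b d * k a c - h b c * k a d

end Algebra

/-! ### Koszul form and curvature in a coordinate domain

`E` is the coordinate space, `g` a field of symmetric bilinear forms on (an open subset of) `E`.
A vector `a : E` also stands for the constant vector field with value `a`; for the vectors of a
basis of `E` these are the coordinate fields `∂_a`. -/

section Coordinates

variable {E : Type*} [NormedAddCommGroup E] [NormedSpace ℝ E]

/-- The Koszul form `K(X, Y, Z)` of the vector fields `X`, `Y`, `Z`, at the point `x`. -/
def koszul (g : E → E →L[ℝ] E →L[ℝ] ℝ) (X Y Z : E → E) (x : E) : ℝ :=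
  (1 / 2) *
    (fderiv ℝ (fun y => g y (Y y) (Z y)) x (X x)
      + fderiv ℝ (fun y => g y (Z y) (X y)) x (Y x)
      - fderiv ℝ (fun y => g y (X y) (Y y)) x (Z x)
      - g x (X x) (VectorField.lieBracket ℝ Y Z x)
      + g x (Y x) (VectorField.lieBracket ℝ Z X x)
      + g x (Z x) (VectorField.lieBracket ℝ X Y x))

/-- The `1`-form `K(X, Y, _)` at the point `x`. The Koszul form is tensorial in its last slot, so it
is evaluated at a vector `w` by means of the constant vector field `w`. -/
def koszulForm (g : E → E →L[ℝ] E →L[ℝ] ℝ) (X Y : E → E) (x : E) : E → ℝ :=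
  fun w => koszul g X Y (fun _ => w) x

/-- Christoffel's symbols of the first kind, `Γ_{abc} = K(∂_a, ∂_b, ∂_c)`. -/
def christoffel (g : E → E →L[ℝ] E →L[ℝ] ℝ) (x : E) (a b c : E) : ℝ :=
  koszul g (fun _ => a) (fun _ => b) (fun _ => c) x

/-- The Riemann curvature
`R_{abcd} = ∂_a Γ_{bcd} - ∂_b Γ_{acd} + Γ_{ac•} Γ_{bd•} - Γ_{bc•} Γ_{ad•}`. -/
def riemann (g : E → E →L[ℝ] E →L[ℝ] ℝ) (x : E) (a b c d : E) : ℝ :=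
  fderiv ℝ (fun y => christoffel g y b c d) x a
    - fderiv ℝ (fun y => christoffel g y a c d) x b
    + contraction (g x) (christoffel g x a c) (christoffel g x b d)
    - contraction (g x) (christoffel g x b c) (christoffel g x a d)

variable [FiniteDimensional ℝ E]

/-- The Ricci curvature `R_{ab} = g^{st} R_{asbt}`, at points where `g` is non-degenerate. -/
def ricci (g : E → E →L[ℝ] E →L[ℝ] ℝ) (x : E) (a b : E) : ℝ :=
  inverseTrace (g x) (fun s t => riemann g x a s b t)

/-- The scalar curvature `R = g^{st} R_{st}`, at points where `g` is non-degenerate. -/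
def scalarCurvature (g : E → E →L[ℝ] E →L[ℝ] ℝ) (x : E) : ℝ :=
  inverseTrace (g x) (ricci g x)

/-- The traceless part `S_{ab} = R_{ab} - R g_{ab} / n` of the Ricci curvature. -/
def tracelessRicci (g : E → E →L[ℝ] E →L[ℝ] ℝ) (x : E) (a b : E) : ℝ :=
  ricci g x a b - 1 / (finrank ℝ E : ℝ) * scalarCurvature g x * g x a b

/-- The scalar part `S_{abcd} = R (g ∘ g)_{abcd} / (2 n (n - 1))` of the Riemann curvature. -/
def scalarPart (g : E → E →L[ℝ] E →L[ℝ] ℝ) (x : E) (a b c d : E) : ℝ :=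
  1 / (2 * (finrank ℝ E : ℝ) * ((finrank ℝ E : ℝ) - 1)) * scalarCurvature g x *
    kulkarniNomizu (fun u v => g x u v) (fun u v => g x u v) a b c d

/-- The semi-traceless part `E_{abcd} = (S ∘ g)_{abcd} / (n - 2)` of the Riemann curvature, for
dimension `n ≥ 3`. -/
def semiTracelessPart (g : E → E →L[ℝ] E →L[ℝ] ℝ) (x : E) (a b c d : E) : ℝ :=
  1 / ((finrank ℝ E : ℝ) - 2) *
    kulkarniNomizu (tracelessRicci g x) (fun u v => g x u v) a b c d

/-- The Weyl curvature `C_{abcd} = R_{abcd} - S_{abcd} - E_{abcd}`. -/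
def weyl (g : E → E →L[ℝ] E →L[ℝ] ℝ) (x : E) (a b c d : E) : ℝ :=
  riemann g x a b c d - scalarPart g x a b c d - semiTracelessPart g x a b c d

/-- The field of covariant `4`-tensors `T`, defined at the points of `U` where `g` is
non-degenerate, extends smoothly to `U`. (Where the non-degenerate points are dense, the extension
is unique, so extensions over different coordinate domains fit together.) -/
def ExtendsSmoothly (g : E → E →L[ℝ] E →L[ℝ] ℝ) (U : Set E)
    (T : E → E → E → E → E → ℝ) : Prop :=
  ∀ a b c d : E, ∃ f : E → ℝ, ContDiffOn ℝ ∞ f U ∧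
    ∀ x ∈ U, IsNondegenerateForm (g x) → f x = T x a b c d

end Coordinates

/-! ### Singular semi-Riemannian manifolds -/

section Manifolds

variable {E : Type*} [NormedAddCommGroup E] [NormedSpace ℝ E]
  {H : Type*} [TopologicalSpace H] (I : ModelWithCorners ℝ E H)
  {M : Type*} [TopologicalSpace M] [ChartedSpace H M]

/-- The components, in the chart `e`, of a field of bilinear forms on the tangent spaces: its
pull-back under the parametrization `(e.extend I).symm`, a field of bilinear forms on
`(e.extend I).target`, which is an open subset of `E` when `I` is boundaryless. -/
def chartMetric (g : ∀ p : M, TangentSpace I p →L[ℝ] TangentSpace I p →L[ℝ] ℝ)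
    (e : OpenPartialHomeomorph M H) (x : E) : E →L[ℝ] E →L[ℝ] ℝ :=
  (ContinuousLinearMap.precomp ℝ (mfderiv 𝓘(ℝ, E) I (e.extend I).symm x)).comp
    ((g ((e.extend I).symm x)).comp (mfderiv 𝓘(ℝ, E) I (e.extend I).symm x))

/-- A singular semi-Riemannian metric: a smooth field of symmetric bilinear forms on the tangent
spaces, possibly degenerate, possibly with changing signature. -/
structure IsSingularMetric [I.Boundaryless] [IsManifold I ∞ M]
    (g : ∀ p : M, TangentSpace I p →L[ℝ] TangentSpace I p →L[ℝ] ℝ) : Prop where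
  symm : ∀ (p : M) (u v : TangentSpace I p), g p u v = g p v u
  smooth : ∀ e ∈ IsManifold.maximalAtlas I ∞ M,
    ContDiffOn ℝ ∞ (chartMetric I g e) (e.extend I).target

/-- A semi-regular metric: for all local smooth vector fields `X`, `Y`, `Z`, `T`, the `1`-form
`K(X, Y, _)` has its values in `♭(T_pM)`, and the contraction `K(X, Y, •) K(Z, T, •)` is smooth.
Both are local conditions, so local vector fields on coordinate domains suffice. -/
structure IsSemiRegular [I.Boundaryless] [IsManifold I ∞ M]
    (g : ∀ p : M, TangentSpace I p →L[ℝ] TangentSpace I p →L[ℝ] ℝ) : Prop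
    extends IsSingularMetric I g where
  koszul_inFlat : ∀ e ∈ IsManifold.maximalAtlas I ∞ M,
    ∀ V : Set E, IsOpen V → V ⊆ (e.extend I).target →
    ∀ X Y : E → E, ContDiffOn ℝ ∞ X V → ContDiffOn ℝ ∞ Y V →
    ∀ x ∈ V, InFlat (chartMetric I g e x) (koszulForm (chartMetric I g e) X Y x)
  contraction_smooth : ∀ e ∈ IsManifold.maximalAtlas I ∞ M,
    ∀ V : Set E, IsOpen V → V ⊆ (e.extend I).target →
    ∀ X Y Z T : E → E, ContDiffOn ℝ ∞ X V → ContDiffOn ℝ ∞ Y V →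
      ContDiffOn ℝ ∞ Z V → ContDiffOn ℝ ∞ T V →
    ContDiffOn ℝ ∞ (fun x => contraction (chartMetric I g e x)
      (koszulForm (chartMetric I g e) X Y x) (koszulForm (chartMetric I g e) Z T x)) V

/-- A semi-regular spacetime: a `4`-dimensional manifold with a semi-regular metric which has at
each point at most three positive and at most one negative directions, and which is non-degenerate
on a dense subset. -/
structure IsSemiRegularSpacetime [I.Boundaryless] [IsManifold I ∞ M]
    (g : ∀ p : M, TangentSpace I p →L[ℝ] TangentSpace I p →L[ℝ] ℝ) : Prop
    extends IsSemiRegular I g where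
  dim_eq : finrank ℝ E = 4
  sigPos_le : ∀ p : M, sigPos (LinearMap.BilinMap.toQuadraticMap (g p).toLinearMap₁₂) ≤ 3
  sigNeg_le : ∀ p : M, sigNeg (LinearMap.BilinMap.toQuadraticMap (g p).toLinearMap₁₂) ≤ 1
  dense_nondegenerate : Dense {p : M | IsNondegenerateForm (g p)}

/-- A quasi-regular metric: a semi-regular metric, non-degenerate on a dense subset, for which the
tensors `S_{abcd}` and `E_{abcd}`, defined where the metric is non-degenerate, extend smoothly to
the entire manifold. -/
structure IsQuasiRegular [FiniteDimensional ℝ E] [I.Boundaryless] [IsManifold I ∞ M]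
    (g : ∀ p : M, TangentSpace I p →L[ℝ] TangentSpace I p →L[ℝ] ℝ) : Prop
    extends IsSemiRegular I g where
  dense_nondegenerate : Dense {p : M | IsNondegenerateForm (g p)}
  scalarPart_extends : ∀ e ∈ IsManifold.maximalAtlas I ∞ M,
    ExtendsSmoothly (chartMetric I g e) (e.extend I).target (scalarPart (chartMetric I g e))
  semiTracelessPart_extends : ∀ e ∈ IsManifold.maximalAtlas I ∞ M,
    ExtendsSmoothly (chartMetric I g e) (e.extend I).target
      (semiTracelessPart (chartMetric I g e))

/-- A quasi-regular spacetime: a quasi-regular manifold which is a semi-regular spacetime. -/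
def IsQuasiRegularSpacetime [FiniteDimensional ℝ E] [I.Boundaryless] [IsManifold I ∞ M]
    (g : ∀ p : M, TangentSpace I p →L[ℝ] TangentSpace I p →L[ℝ] ℝ) : Prop :=
  IsQuasiRegular I g ∧ IsSemiRegularSpacetime I g

end Manifolds

/-! ### The Schwarzschild spacetime -/

section Schwarzschild

/-- The unit sphere `S²`. -/
abbrev UnitSphere : Type := Metric.sphere (0 : EuclideanSpace ℝ (Fin 3)) 1

/-- The Schwarzschild line element of mass `m`,
`ds² = -(1 - 2m/r) dt² + (1 - 2m/r)⁻¹ dr² + r² dσ²`, with real functions `t`, `r` and a map `n` to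
the unit sphere, on some manifold, substituted for the Schwarzschild coordinates. Here `dσ²` is the
metric of `S²` induced by the inclusion `S² ⊆ ℝ³`. -/
def schwarzschildLineElement {E : Type*} [NormedAddCommGroup E] [NormedSpace ℝ E]
    {H : Type*} [TopologicalSpace H] (I : ModelWithCorners ℝ E H)
    {M : Type*} [TopologicalSpace M] [ChartedSpace H M]
    (m : ℝ) (t r : M → ℝ) (n : M → UnitSphere) (p : M) (u v : TangentSpace I p) : ℝ :=
  -(1 - 2 * m / r p) * (mvfderiv I t p u * mvfderiv I t p v)
    + (1 - 2 * m / r p)⁻¹ * (mvfderiv I r p u * mvfderiv I r p v)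
    + r p ^ 2 * inner ℝ (mvfderiv I (fun q => (n q : EuclideanSpace ℝ (Fin 3))) p u)
        (mvfderiv I (fun q => (n q : EuclideanSpace ℝ (Fin 3))) p v)

/-- The domain of the coordinates `(τ, ξ)`: the horizon `r = τ² = 2m` is excluded. -/
def tauXiDomain (m : ℝ) : TopologicalSpace.Opens (ℝ × ℝ) :=
  ⟨{x | 2 * m - x.1 ^ 2 ≠ 0}, isOpen_ne_fun (by fun_prop) (by fun_prop)⟩

/-- The manifold of all `(τ, ξ, n)` with `2m - τ² ≠ 0` and `n ∈ S²`. -/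
abbrev SchwarzschildManifold (m : ℝ) : Type := tauXiDomain m × UnitSphere

/-- The model with corners of `SchwarzschildManifold m`. -/
abbrev schwarzschildModel :
    ModelWithCorners ℝ ((ℝ × ℝ) × EuclideanSpace ℝ (Fin 2))
      (ModelProd (ℝ × ℝ) (EuclideanSpace ℝ (Fin 2))) :=
  𝓘(ℝ, ℝ × ℝ).prod (𝓡 2)

namespace SchwarzschildManifold

variable {m : ℝ}

/-- The coordinate function `τ`. -/
def tau (p : SchwarzschildManifold m) : ℝ := p.1.1.1

/-- The coordinate function `ξ`. -/
def xi (p : SchwarzschildManifold m) : ℝ := p.1.1.2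

/-- The projection to the unit sphere. -/
def sph (p : SchwarzschildManifold m) : UnitSphere := p.2

/-- The same, as a map to `ℝ³`. -/
def sphVec (p : SchwarzschildManifold m) : EuclideanSpace ℝ (Fin 3) := p.2

/-- The `1`-form `dτ`. -/
def dTau (p : SchwarzschildManifold m) : TangentSpace schwarzschildModel p →L[ℝ] ℝ :=
  mvfderiv schwarzschildModel tau p

/-- The `1`-form `dξ`. -/
def dXi (p : SchwarzschildManifold m) : TangentSpace schwarzschildModel p →L[ℝ] ℝ :=
  mvfderiv schwarzschildModel xi p

/-- The metric `dσ²` of the unit sphere, as a field of bilinear forms. -/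
def sphereMetric (p : SchwarzschildManifold m) :
    TangentSpace schwarzschildModel p →L[ℝ] TangentSpace schwarzschildModel p →L[ℝ] ℝ :=
  (ContinuousLinearMap.precomp ℝ (mvfderiv schwarzschildModel sphVec p)).comp
    ((innerSL ℝ).comp (mvfderiv schwarzschildModel sphVec p))

/-- The metric
`ds² = -4τ⁴ / (2m - τ²) dτ² + (2m - τ²) τ⁴ (4ξ dτ + τ dξ)² + τ⁴ dσ²`.
For `1`-forms `α`, `β`, the term `α.smulRight β` is the bilinear form `(u, v) ↦ α u * β v`. -/
def metric (m : ℝ) (p : SchwarzschildManifold m) :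
    TangentSpace schwarzschildModel p →L[ℝ] TangentSpace schwarzschildModel p →L[ℝ] ℝ :=
  -(4 * tau p ^ 4 / (2 * m - tau p ^ 2)) • (dTau p).smulRight (dTau p)
    + ((2 * m - tau p ^ 2) * tau p ^ 4) •
      ((4 * xi p) • dTau p + tau p • dXi p).smulRight ((4 * xi p) • dTau p + tau p • dXi p)
    + tau p ^ 4 • sphereMetric p

end SchwarzschildManifold

end Schwarzschild

end

/-! ### Linear algebra of a single form: contraction on the image of flat, and inverse traces. -/

section PointwiseAlgebra

variable {V : Type*} [NormedAddCommGroup V] [NormedSpace ℝ V]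

/-! In any smooth chart the metric is `g = τ⁴ h`, where `h` (`conformalMetric`) is smooth off the
excluded horizon. Everything rests on counting powers of `τ`.

Semi-regularity. Differentiating `τ⁴ h` once costs at most one power of `τ`, so every Koszul form of
`g` is `τ³ K'` with `K'` smooth (`koszulForm_eq_mul`). The inverse of `h` has a pole of order at
most two at `τ = 0`: `τ² h⁻¹` is an explicit smooth expression in a smooth frame
(`conformalMetric_eq_sum`). The contraction of two Koszul forms is therefore `τ³ τ³ τ⁻⁴ h⁻¹(K', K')
= (τ² h⁻¹)(K', K')`, which is smooth across `τ = 0`. On `τ = 0` itself `g` vanishes identically, so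
flat has image zero. There the Koszul forms vanish too, and the smooth expression takes the required
value `0` because `K'` kills `∂_ξ` (`contraction_koszulForm`). Smoothness of `R_{abcd}` is a
corollary, since it is built from derivatives of `Γ` and such contractions.

Vacuum. Where `τ ≠ 0`, `g` is locally the pull-back of the Kerr–Schild form of the Schwarzschild
metric on `ℝ × ℝ³`, in which `Γ` and the curvature are polynomial in `m`, `1/r`, `dt`, `dr` and the
flat inner product (`riemann_kerrSchild`). Naturality of the curvature (`riemann_pullback`)
transports the result to the chart. With `A` the angular part and `B = g - A`, the curvature is `-m
r⁻³ (A∘A + B∘B - B∘A)`. Both parts have rank two and trace two, so the three products trace to `2A`,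
`2B` and `2A + 2B`, and the Ricci tensor vanishes. Hence `S_{abcd}` and `E_{abcd}` are zero on the
dense set `τ ≠ 0` and extend by zero.

The local computations are carried out for abstract data `τ`, `ξ`, `n` on an open set
(`IsPolarDomain`), with the sphere embedded in `ℝ³`; every chart of the maximal atlas supplies such
data. -/

lemma contraction_eq {B : V →L[ℝ] V →L[ℝ] ℝ} (hB : ∀ u v, B u v = B v u) {φ ψ : V → ℝ} {u v : V}
    (hφ : ∀ w, φ w = B u w) (hψ : ∀ w, ψ w = B v w) : contraction B φ ψ = B u v := by
  have h : InFlat B φ ∧ InFlat B ψ := ⟨⟨u, hφ⟩, ⟨v, hψ⟩⟩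
  -- `B u' v' = φ v'` depends on the chosen `u'` only through `φ`; by symmetry the same holds for
  -- `v'`.
  rw [contraction, dif_pos h, ← h.1.choose_spec, hφ, hB, ← h.2.choose_spec, hψ, hB]

/-- The inverse trace in an overcomplete frame that represents the inverse of the form. -/
lemma inverseTrace_eq_sum [FiniteDimensional ℝ V] {ι : Type*} [Fintype ι]
    {B : V →L[ℝ] V →L[ℝ] ℝ} (hB : ∀ u v, B u v = B v u) (hnd : IsNondegenerateForm B)
    (T : V →ₗ[ℝ] V →ₗ[ℝ] ℝ) (c : ι → ℝ) (e : ι → V)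
    (h : ∀ u v, B u v = ∑ i, c i * (B u (e i) * B v (e i))) :
    inverseTrace B (fun s t => T s t) = ∑ i, c i * T (e i) (e i) := by
  classical
  set b := Module.finBasis ℝ V with hb
  set M : Matrix (Fin (finrank ℝ V)) (Fin (finrank ℝ V)) ℝ :=
    Matrix.of fun i j => B (b i) (b j) with hM
  set p : Matrix ι (Fin (finrank ℝ V)) ℝ := Matrix.of fun i s => b.repr (e i) s with hp
  have hdet : IsUnit M.det := by
    rw [isUnit_iff_ne_zero]
    intro h0
    obtain ⟨v, hv, hMv⟩ := Matrix.exists_mulVec_eq_zero_iff.2 h0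
    have hz : ∑ j, v j • b j = 0 := by
      have hz : ∀ i, B (b i) (∑ j, v j • b j) = 0 := by
        intro i
        have := congrFun hMv i
        simpa [Matrix.mulVec, dotProduct, hM, map_sum, mul_comm] using this
      generalize ∑ j, v j • b j = z at hz
      apply hnd
      intro w
      rw [← b.sum_repr w, map_sum]
      exact Finset.sum_eq_zero fun i _ => by rw [map_smul, hB, hz, smul_zero]
    exact hv (funext fun j => Fintype.linearIndependent_iff.1 b.linearIndependent v hz j)
  have hBe : ∀ s i, B (b s) (e i) = ∑ t, p i t * M s t := by
    intro s i
    conv_lhs => rw [← b.sum_repr (e i)]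
    simp [map_sum, hp, hM, - Basis.sum_repr]
  -- The expansion of `B` in the `e i` says `M P M = M` with `P = pᵀ diag(c) p`. As `M` is
  -- invertible, `P` is its inverse, even when the `e i` are linearly dependent.
  have hMp : M * (p.transpose * Matrix.diagonal c * p) * M = M * 1 := by
    ext s t
    have hsymm : ∀ i j, M i j = M j i := fun i j => hB _ _
    have h1 : ∀ i, (M * p.transpose) s i = B (b s) (e i) := by
      intro i; rw [hBe, Matrix.mul_apply]; simp [mul_comm]
    have h2 : ∀ i, (p * M) i t = B (b t) (e i) := by
      intro i; rw [hBe, Matrix.mul_apply]; exact Finset.sum_congr rfl fun j _ => by rw [hsymm]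
    have h3 : M * (p.transpose * Matrix.diagonal c * p) * M
        = (M * p.transpose) * Matrix.diagonal c * (p * M) := by simp only [Matrix.mul_assoc]
    rw [h3, Matrix.mul_apply, mul_one]
    simp only [Matrix.mul_diagonal, h1, h2]
    rw [show M s t = B (b s) (b t) from rfl, h]
    exact Finset.sum_congr rfl fun i _ => by ring
  have hinv : M⁻¹ = p.transpose * Matrix.diagonal c * p := by
    have h4 := congrArg (fun A => M⁻¹ * A) hMp
    simp only [← Matrix.mul_assoc, Matrix.nonsing_inv_mul M hdet, Matrix.one_mul] at h4
    exact Matrix.inv_eq_left_inv h4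
  have hT : ∀ i, T (e i) (e i) = ∑ s, ∑ t, p i s * p i t * T (b s) (b t) := by
    intro i
    conv_lhs => rw [← b.sum_repr (e i)]
    simp only [map_sum, LinearMap.sum_apply, map_smul, LinearMap.smul_apply, smul_eq_mul,
      Finset.mul_sum]
    rw [Finset.sum_comm]
    refine Finset.sum_congr rfl fun s _ => Finset.sum_congr rfl fun t _ => ?_
    simp only [hp, Matrix.of_apply]; ring
  change ∑ s, ∑ t, M⁻¹ s t * T (b s) (b t) = _
  simp only [hinv, Matrix.mul_apply (M := p.transpose * Matrix.diagonal c), Matrix.mul_diagonal, hT,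
    Finset.sum_mul, Finset.mul_sum]
  rw [Finset.sum_comm_cycle]
  refine Finset.sum_congr rfl fun i _ => ?_
  refine Finset.sum_congr rfl fun s _ => Finset.sum_congr rfl fun t _ => ?_
  simp only [Matrix.transpose_apply]; ring

end PointwiseAlgebra

/-! ### The Koszul form in coordinates. -/

section KoszulFormulas

variable {E : Type*} [NormedAddCommGroup E] [NormedSpace ℝ E]
  {g : E → E →L[ℝ] E →L[ℝ] ℝ} {x : E}

lemma fderiv_form_apply (hg : DifferentiableAt ℝ g x) (a b c : E) :
    fderiv ℝ (fun y => g y b c) x a = fderiv ℝ g x a b c := by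
  rw [((hg.hasFDerivAt.clm_apply (hasFDerivAt_const b x)).clm_apply (hasFDerivAt_const c x)).fderiv]
  simp

lemma christoffel_eq_fderiv (a b c : E) :
    christoffel g x a b c = 1 / 2 * (fderiv ℝ (fun y => g y b c) x a
      + fderiv ℝ (fun y => g y c a) x b - fderiv ℝ (fun y => g y a b) x c) := by
  simp [christoffel, koszul, VectorField.lieBracket]

lemma christoffel_eq (hg : DifferentiableAt ℝ g x) (a b c : E) :
    christoffel g x a b c =
      1 / 2 * (fderiv ℝ g x a b c + fderiv ℝ g x b c a - fderiv ℝ g x c a b) := by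
  simp only [christoffel_eq_fderiv, fderiv_form_apply hg]

/-- The bracket terms cancel every derivative of `X` and leave a single derivative of `Y`: this is
the tensorial behaviour in `X` and the Leibniz rule in `Y`. -/
lemma koszulForm_eq (hg : DifferentiableAt ℝ g x) (hs : ∀ u v, g x u v = g x v u) {X Y : E → E}
    (hX : DifferentiableAt ℝ X x) (hY : DifferentiableAt ℝ Y x) (w : E) :
    koszulForm g X Y x w = 1 / 2 * (fderiv ℝ g x (X x) (Y x) w + fderiv ℝ g x (Y x) w (X x)
      - fderiv ℝ g x w (X x) (Y x)) + g x (fderiv ℝ Y x (X x)) w := by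
  have key : ∀ {A B : E → E} (_ : DifferentiableAt ℝ A x) (_ : DifferentiableAt ℝ B x) (v : E),
      fderiv ℝ (fun y => g y (A y) (B y)) x v = fderiv ℝ g x v (A x) (B x)
        + g x (fderiv ℝ A x v) (B x) + g x (A x) (fderiv ℝ B x v) := by
    intro A B hA hB v
    rw [((hg.hasFDerivAt.clm_apply hA.hasFDerivAt).clm_apply hB.hasFDerivAt).fderiv]
    simp; ring
  have hw : DifferentiableAt ℝ (fun _ : E => w) x := differentiableAt_const w
  simp only [koszulForm, koszul, key hX hY, key hY hw, key hw hX, VectorField.lieBracket,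
    fderiv_fun_const, Pi.zero_apply, zero_apply, map_zero, zero_sub, sub_zero,
    map_sub, map_neg, add_zero]
  rw [hs w (fderiv ℝ Y x (X x)), hs w, hs (X x) (fderiv ℝ Y x w), hs (Y x) (fderiv ℝ X x w)]
  ring

end KoszulFormulas

/-! ### Naturality of the Christoffel symbols and of the curvature under pull-back. -/

section Pullback

set_option maxSynthPendingDepth 3

variable {E : Type*} [NormedAddCommGroup E] [NormedSpace ℝ E]
  {N : Type*} [NormedAddCommGroup N] [NormedSpace ℝ N]

lemma fderiv_fderiv_comm {F : E → N} {x : E} (hF : ContDiffAt ℝ 2 F x) (u v : E) :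
    fderiv ℝ (fderiv ℝ F) x u v = fderiv ℝ (fderiv ℝ F) x v u :=
  hF.isSymmSndFDerivAt (by rw [minSmoothness_of_isRCLikeNormedField]) u v

lemma hasFDerivAt_fderiv_apply {F : E → N} {x : E} (hF : DifferentiableAt ℝ (fderiv ℝ F) x)
    (v : E) : HasFDerivAt (fun y => fderiv ℝ F y v) ((fderiv ℝ (fderiv ℝ F) x).flip v) x := by
  convert hF.hasFDerivAt.clm_apply (hasFDerivAt_const v x) using 1
  ext w; simp

variable {g : E → E →L[ℝ] E →L[ℝ] ℝ} {G : N → N →L[ℝ] N →L[ℝ] ℝ} {F : E → N} {x : E}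

lemma fderiv_pullback_form (hG : DifferentiableAt ℝ G (F x)) (hF : DifferentiableAt ℝ F x)
    (hF' : DifferentiableAt ℝ (fderiv ℝ F) x) (a b c : E) :
    fderiv ℝ (fun y => G (F y) (fderiv ℝ F y b) (fderiv ℝ F y c)) x a =
      fderiv ℝ G (F x) (fderiv ℝ F x a) (fderiv ℝ F x b) (fderiv ℝ F x c)
      + G (F x) (fderiv ℝ (fderiv ℝ F) x a b) (fderiv ℝ F x c)
      + G (F x) (fderiv ℝ F x b) (fderiv ℝ (fderiv ℝ F) x a c) := by
  have h2 : HasFDerivAt (fun y => G (F y)) ((fderiv ℝ G (F x)).comp (fderiv ℝ F x)) x :=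
    HasFDerivAt.comp x hG.hasFDerivAt hF.hasFDerivAt
  rw [((h2.clm_apply (hasFDerivAt_fderiv_apply hF' b)).clm_apply
    (hasFDerivAt_fderiv_apply hF' c)).fderiv]
  simp; ring

/-- Each of the three Koszul terms produces two second derivatives of `F`. By symmetry of `D²F` and
of `G` four of the six cancel and the other two add up to the inhomogeneous term. -/
lemma christoffel_pullback (hG : DifferentiableAt ℝ G (F x))
    (hs : ∀ u v, G (F x) u v = G (F x) v u) (hF : ContDiffAt ℝ 2 F x)
    (hg : ∀ᶠ y in nhds x, ∀ u v, g y u v = G (F y) (fderiv ℝ F y u) (fderiv ℝ F y v))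
    (a b c : E) :
    christoffel g x a b c = christoffel G (F x) (fderiv ℝ F x a) (fderiv ℝ F x b) (fderiv ℝ F x c)
      + G (F x) (fderiv ℝ (fderiv ℝ F) x a b) (fderiv ℝ F x c) := by
  have hF1 : DifferentiableAt ℝ F x := hF.differentiableAt (by simp)
  have hF2 : DifferentiableAt ℝ (fderiv ℝ F) x :=
    (hF.fderiv_right (m := 1) (by norm_num)).differentiableAt (by simp)
  have hsymm := fderiv_fderiv_comm hF
  have key : ∀ b c : E, fderiv ℝ (fun y => g y b c) x =
      fderiv ℝ (fun y => G (F y) (fderiv ℝ F y b) (fderiv ℝ F y c)) x := fun b c =>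
    Filter.EventuallyEq.fderiv_eq (hg.mono fun y hy => hy b c)
  simp only [christoffel_eq_fderiv (g := g), christoffel_eq hG, key, fderiv_pullback_form hG hF1 hF2]
  rw [hsymm b a, hsymm c a, hsymm c b,
    hs (fderiv ℝ F x c), hs (fderiv ℝ F x a), hs (fderiv ℝ F x b)]
  ring

lemma fderiv_christoffel {y : N} (hG : ContDiffAt ℝ ∞ G y) (a b c d : N) :
    fderiv ℝ (fun y => christoffel G y b c d) y a = 1 / 2 * (fderiv ℝ (fderiv ℝ G) y a b c d
      + fderiv ℝ (fderiv ℝ G) y a c d b - fderiv ℝ (fderiv ℝ G) y a d b c) := by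
  have hG2 : DifferentiableAt ℝ (fderiv ℝ G) y :=
    (hG.fderiv_right (m := ∞) le_rfl).differentiableAt (by simp)
  have hev : (fun y => christoffel G y b c d) =ᶠ[nhds y] fun y =>
      1 / 2 * (fderiv ℝ G y b c d + fderiv ℝ G y c d b - fderiv ℝ G y d b c) :=
    ((hG.of_le (by decide : (2 : WithTop ℕ∞) ≤ ∞)).eventually (by simp)).mono fun z hz => christoffel_eq (hz.differentiableAt (by simp)) b c d
  have h1 : ∀ b c d : N, HasFDerivAt (fun y => fderiv ℝ G y b c d) _ y := fun b c d =>
    ((hasFDerivAt_fderiv_apply hG2 b).clm_apply (hasFDerivAt_const c y)).clm_apply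
      (hasFDerivAt_const d y)
  rw [hev.fderiv_eq, ((((h1 b c d).fun_add (h1 c d b)).fun_sub (h1 d b c)).const_mul (1 / 2)).fderiv]
  simp

lemma fderiv_christoffel_pullback (hG : ContDiffAt ℝ ∞ G (F x))
    (hs : ∀ᶠ y in nhds (F x), ∀ u v, G y u v = G y v u) (hF : ContDiffAt ℝ ∞ F x)
    (hg : ∀ᶠ y in nhds x, ∀ u v, g y u v = G (F y) (fderiv ℝ F y u) (fderiv ℝ F y v))
    (a b c d : E) :
    fderiv ℝ (fun y => christoffel g y b c d) x a =
      fderiv ℝ (fun y => christoffel G y (fderiv ℝ F x b) (fderiv ℝ F x c) (fderiv ℝ F x d)) (F x)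
        (fderiv ℝ F x a)
      + christoffel G (F x) (fderiv ℝ (fderiv ℝ F) x a b) (fderiv ℝ F x c) (fderiv ℝ F x d)
      + christoffel G (F x) (fderiv ℝ F x b) (fderiv ℝ (fderiv ℝ F) x a c) (fderiv ℝ F x d)
      + christoffel G (F x) (fderiv ℝ F x b) (fderiv ℝ F x c) (fderiv ℝ (fderiv ℝ F) x a d)
      + fderiv ℝ G (F x) (fderiv ℝ F x a) (fderiv ℝ (fderiv ℝ F) x b c) (fderiv ℝ F x d)
      + G (F x) (fderiv ℝ (fderiv ℝ (fderiv ℝ F)) x a b c) (fderiv ℝ F x d)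
      + G (F x) (fderiv ℝ (fderiv ℝ F) x b c) (fderiv ℝ (fderiv ℝ F) x a d) := by
  have hF1 : DifferentiableAt ℝ F x := hF.differentiableAt (by simp)
  have hF2' : ContDiffAt ℝ ∞ (fderiv ℝ F) x := hF.fderiv_right le_rfl
  have hF2 : DifferentiableAt ℝ (fderiv ℝ F) x := hF2'.differentiableAt (by simp)
  have hF3 : DifferentiableAt ℝ (fderiv ℝ (fderiv ℝ F)) x :=
    (hF2'.fderiv_right (m := ∞) le_rfl).differentiableAt (by simp)
  have hG1 : DifferentiableAt ℝ G (F x) := hG.differentiableAt (by simp)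
  have hG2 : DifferentiableAt ℝ (fderiv ℝ G) (F x) :=
    (hG.fderiv_right (m := ∞) le_rfl).differentiableAt (by simp)
  have hev : (fun y => christoffel g y b c d) =ᶠ[nhds x] fun y =>
      1 / 2 * (fderiv ℝ G (F y) (fderiv ℝ F y b) (fderiv ℝ F y c) (fderiv ℝ F y d)
        + fderiv ℝ G (F y) (fderiv ℝ F y c) (fderiv ℝ F y d) (fderiv ℝ F y b)
        - fderiv ℝ G (F y) (fderiv ℝ F y d) (fderiv ℝ F y b) (fderiv ℝ F y c))
      + G (F y) (fderiv ℝ (fderiv ℝ F) y b c) (fderiv ℝ F y d) := by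
    have h2 : (2 : WithTop ℕ∞) ≤ ∞ := by decide
    filter_upwards [hg.eventually_nhds, (hF.of_le h2).eventually (by simp),
      hF.continuousAt.eventually ((hG.of_le h2).eventually (by simp)),
      hF.continuousAt.eventually hs]
      with y h1 h2 h3 h4
    have h5 : DifferentiableAt ℝ G (F y) := h3.differentiableAt (by simp)
    rw [christoffel_pullback h5 h4 h2 h1, christoffel_eq h5]
  have hDF := hasFDerivAt_fderiv_apply hF2
  have hGF : HasFDerivAt (fun y => G (F y)) ((fderiv ℝ G (F x)).comp (fderiv ℝ F x)) x :=
    HasFDerivAt.comp x hG1.hasFDerivAt hF1.hasFDerivAt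
  have hG'F : HasFDerivAt (fun y => fderiv ℝ G (F y))
      ((fderiv ℝ (fderiv ℝ G) (F x)).comp (fderiv ℝ F x)) x :=
    HasFDerivAt.comp x hG2.hasFDerivAt hF1.hasFDerivAt
  have h1 := fun b c d => ((hG'F.clm_apply (hDF b)).clm_apply (hDF c)).clm_apply (hDF d)
  have h2 := (hGF.clm_apply ((hasFDerivAt_fderiv_apply hF3 b).clm_apply
    (hasFDerivAt_const c x))).clm_apply (hDF d)
  rw [hev.fderiv_eq,
    (((((h1 b c d).fun_add (h1 c d b)).fun_sub (h1 d b c)).const_mul (1 / 2)).fun_add h2).fderiv]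
  simp only [fderiv_christoffel hG, christoffel_eq hG1]
  simp
  ring

/-- The Riemann curvature is natural under local diffeomorphisms. -/
theorem riemann_pullback (hG : ContDiffAt ℝ ∞ G (F x))
    (hs : ∀ᶠ y in nhds (F x), ∀ u v, G y u v = G y v u) (hF : ContDiffAt ℝ ∞ F x)
    (hF' : Function.Surjective (fderiv ℝ F x))
    (hg : ∀ᶠ y in nhds x, ∀ u v, g y u v = G (F y) (fderiv ℝ F y u) (fderiv ℝ F y v))
    (hflat : ∀ a b, InFlat (G (F x)) (christoffel G (F x) a b)) (a b c d : E) :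
    riemann g x a b c d = riemann G (F x) (fderiv ℝ F x a) (fderiv ℝ F x b) (fderiv ℝ F x c)
      (fderiv ℝ F x d) := by
  have hs0 := hs.self_of_nhds
  have hg0 := hg.self_of_nhds
  have hG1 : DifferentiableAt ℝ G (F x) := hG.differentiableAt (by simp)
  have hsymm : ∀ u v, fderiv ℝ (fderiv ℝ F) x u v = fderiv ℝ (fderiv ℝ F) x v u :=
    fderiv_fderiv_comm (hF.of_le (by decide))
  have hsymm3 : ∀ u v w, fderiv ℝ (fderiv ℝ (fderiv ℝ F)) x u v w =
      fderiv ℝ (fderiv ℝ (fderiv ℝ F)) x v u w := fun u v w => congrArg (· w)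
    (fderiv_fderiv_comm ((hF.fderiv_right (m := ∞) le_rfl).of_le (by decide)) u v)
  have hsG : ∀ w u v, fderiv ℝ G (F x) w u v = fderiv ℝ G (F x) w v u := by
    intro w u v
    rw [← fderiv_form_apply hG1, ← fderiv_form_apply hG1]
    congr 1
    exact Filter.EventuallyEq.fderiv_eq (hs.mono fun y hy => hy u v)
  choose Γ hΓ using hflat
  choose S hS using hF'
  have hsg : ∀ u v, g x u v = g x v u := fun u v => by rw [hg0, hg0, hs0]
  -- Surjectivity of `DF` lifts the vector representing `Γ` of `G`, corrected by `D²F(a, b)`, to a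
  -- vector that represents `Γ` of `g`; contractions for `g` can then be evaluated on the lifts.
  have hchr : ∀ a b w, christoffel g x a b w =
      g x (S (Γ (fderiv ℝ F x a) (fderiv ℝ F x b) + fderiv ℝ (fderiv ℝ F) x a b)) w := by
    intro a b w
    rw [christoffel_pullback hG1 hs0 (hF.of_le (by decide)) hg, hg0, hS, map_add, add_apply, hΓ]
  have hcon : ∀ a b c d, contraction (g x) (christoffel g x a b) (christoffel g x c d) =
      contraction (G (F x)) (christoffel G (F x) (fderiv ℝ F x a) (fderiv ℝ F x b))
        (christoffel G (F x) (fderiv ℝ F x c) (fderiv ℝ F x d))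
      + christoffel G (F x) (fderiv ℝ F x a) (fderiv ℝ F x b) (fderiv ℝ (fderiv ℝ F) x c d)
      + christoffel G (F x) (fderiv ℝ F x c) (fderiv ℝ F x d) (fderiv ℝ (fderiv ℝ F) x a b)
      + G (F x) (fderiv ℝ (fderiv ℝ F) x a b) (fderiv ℝ (fderiv ℝ F) x c d) := by
    intro a b c d
    rw [contraction_eq hsg (hchr a b) (hchr c d), hg0, hS, hS,
      contraction_eq hs0 (hΓ _ _) (hΓ _ _), hΓ, hΓ, hs0 (Γ _ _) (fderiv ℝ (fderiv ℝ F) x a b)]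
    simp only [map_add, add_apply]
    ring
  -- The terms `G(D²F, D²F)` of the derivatives cancel those of the contractions, and the third
  -- derivatives of `F` cancel by symmetry in `a`, `b`. What is left cancels by symmetry of `DG` in
  -- its last two slots.
  simp only [riemann, hcon, fderiv_christoffel_pullback hG hs hF hg]
  rw [hsymm b a, hsymm3 b a]
  simp only [christoffel_eq hG1]
  rw [hs0 (fderiv ℝ (fderiv ℝ F) x b c)]
  linear_combination (-1 / 2) * hsG (fderiv ℝ F x b) (fderiv ℝ (fderiv ℝ F) x a c) (fderiv ℝ F x d)
    + 1 / 2 * hsG (fderiv ℝ F x a) (fderiv ℝ (fderiv ℝ F) x b c) (fderiv ℝ F x d)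
    - 1 / 2 * hsG (fderiv ℝ F x d) (fderiv ℝ F x b) (fderiv ℝ (fderiv ℝ F) x a c)
    + 1 / 2 * hsG (fderiv ℝ F x d) (fderiv ℝ F x a) (fderiv ℝ (fderiv ℝ F) x b c)
    + 1 / 2 * hsG (fderiv ℝ (fderiv ℝ F) x a c) (fderiv ℝ F x d) (fderiv ℝ F x b)
    - 1 / 2 * hsG (fderiv ℝ (fderiv ℝ F) x b c) (fderiv ℝ F x d) (fderiv ℝ F x a)

end Pullback

/-! ### Curvature of the Schwarzschild metric in Kerr–Schild form. -/

section KerrSchild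

set_option maxSynthPendingDepth 3

variable {W : Type*} [NormedAddCommGroup W] [InnerProductSpace ℝ W]

/-- The differential `dr` of the radius function `r = ‖y.2‖` of `ℝ × W`. -/
noncomputable def radialForm (y : ℝ × W) : ℝ × W →L[ℝ] ℝ :=
  ‖y.2‖⁻¹ • (innerSL ℝ y.2).comp (ContinuousLinearMap.snd ℝ ℝ W)

/-- The null form `dt + dr`. -/
noncomputable def nullForm (y : ℝ × W) : ℝ × W →L[ℝ] ℝ :=
  ContinuousLinearMap.fst ℝ ℝ W + radialForm y

/-- The Schwarzschild metric in Kerr–Schild form, `-dt² + |dx|² + (2m / r) (dt + dr)²`. -/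
noncomputable def kerrSchild (m : ℝ) (y : ℝ × W) : ℝ × W →L[ℝ] ℝ × W →L[ℝ] ℝ :=
  -(ContinuousLinearMap.fst ℝ ℝ W).smulRight (ContinuousLinearMap.fst ℝ ℝ W)
    + ((ContinuousLinearMap.precomp ℝ (ContinuousLinearMap.snd ℝ ℝ W)).comp
        ((innerSL ℝ).comp (ContinuousLinearMap.snd ℝ ℝ W)) : ℝ × W →L[ℝ] ℝ × W →L[ℝ] ℝ)
    + (2 * m * ‖y.2‖⁻¹) • (nullForm y).smulRight (nullForm y)

/-- The metric `r² dσ²` of the orbits of the rotation group. -/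
noncomputable def angularForm (y u v : ℝ × W) : ℝ :=
  inner ℝ u.2 v.2 - radialForm y u * radialForm y v

lemma radialForm_apply (y u : ℝ × W) : radialForm y u = ‖y.2‖⁻¹ * inner ℝ y.2 u.2 := by
  simp [radialForm]

lemma nullForm_apply (y u : ℝ × W) : nullForm y u = u.1 + radialForm y u := by
  simp [nullForm]

lemma kerrSchild_apply (m : ℝ) (y u v : ℝ × W) : kerrSchild m y u v =
    -(u.1 * v.1) + inner ℝ u.2 v.2 + 2 * m * ‖y.2‖⁻¹ * (nullForm y u * nullForm y v) := by
  simp [kerrSchild]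

lemma kerrSchild_symm (m : ℝ) (y u v : ℝ × W) : kerrSchild m y u v = kerrSchild m y v u := by
  simp only [kerrSchild_apply, real_inner_comm]; ring

variable {y : ℝ × W}

lemma contDiffAt_inv_norm_snd (hy : y.2 ≠ 0) : ContDiffAt ℝ ∞ (fun y : ℝ × W => ‖y.2‖⁻¹) y :=
  (contDiffAt_snd.norm ℝ hy).inv (norm_ne_zero_iff.2 hy)

lemma contDiffAt_radialForm (hy : y.2 ≠ 0) : ContDiffAt ℝ ∞ (radialForm (W := W)) y :=
  (contDiffAt_inv_norm_snd hy).smul (((innerSL ℝ).contDiff.contDiffAt.comp y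
    contDiffAt_snd).clm_comp contDiffAt_const)

lemma contDiffAt_kerrSchild (m : ℝ) (hy : y.2 ≠ 0) :
    ContDiffAt ℝ ∞ (kerrSchild m (W := W)) y := by
  have h1 : ContDiffAt ℝ ∞ (nullForm (W := W)) y :=
    contDiffAt_const.add (contDiffAt_radialForm hy)
  unfold kerrSchild
  exact contDiffAt_const.add ((contDiffAt_const.mul (contDiffAt_inv_norm_snd hy)).fun_smul
    (h1.smulRight h1))

lemma hasFDerivAt_norm_snd (hy : y.2 ≠ 0) :
    HasFDerivAt (fun y : ℝ × W => ‖y.2‖) (radialForm y) y := by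
  have h1 : HasFDerivAt (fun y : ℝ × W => ‖y.2‖ ^ 2) _ y := (hasFDerivAt_snd (𝕜 := ℝ)).norm_sq
  have h2 := h1.sqrt (pow_ne_zero 2 (norm_ne_zero_iff.2 hy))
  simp only [Real.sqrt_sq (norm_nonneg _)] at h2
  refine h2.congr_fderiv ?_
  ext
  · simp [radialForm]
  · simp [radialForm]; ring

lemma hasFDerivAt_inv_norm_snd (hy : y.2 ≠ 0) :
    HasFDerivAt (fun y : ℝ × W => ‖y.2‖⁻¹) (-(‖y.2‖⁻¹ ^ 2) • radialForm y) y := by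
  rw [inv_pow]
  exact (hasDerivAt_inv (norm_ne_zero_iff.2 hy)).comp_hasFDerivAt y (hasFDerivAt_norm_snd hy)

lemma hasFDerivAt_radialForm_apply (hy : y.2 ≠ 0) (b : ℝ × W) :
    HasFDerivAt (fun y => radialForm y b) (‖y.2‖⁻¹ •
      ((innerSL ℝ b.2).comp (ContinuousLinearMap.snd ℝ ℝ W) - radialForm y b • radialForm y)) y := by
  have h1 : HasFDerivAt (fun y : ℝ × W => inner ℝ y.2 b.2) _ y :=
    (hasFDerivAt_snd (𝕜 := ℝ)).inner ℝ (hasFDerivAt_const b.2 y)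
  simp only [radialForm_apply]
  refine ((hasFDerivAt_inv_norm_snd hy).fun_mul h1).congr_fderiv ?_
  ext
  · simp [radialForm]
  · simp [radialForm, real_inner_comm]; ring

/-- Only the term `(2m/r)(dt + dr)²` is not constant. The rules are `d(1/r) = -r⁻² dr`, and that the
derivative of `dr(b)` along `a` is the angular form of `a`, `b` divided by `r`. -/
lemma fderiv_kerrSchild_apply (m : ℝ) (hy : y.2 ≠ 0) (a b c : ℝ × W) :
    fderiv ℝ (fun y => kerrSchild m y b c) y a = 2 * m * ‖y.2‖⁻¹ ^ 2 *
      (angularForm y a b * nullForm y c + angularForm y a c * nullForm y b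
        - radialForm y a * nullForm y b * nullForm y c) := by
  have hn := fun b => (hasFDerivAt_const (b : ℝ × W).1 y).fun_add (hasFDerivAt_radialForm_apply hy b)
  have h := ((((hasFDerivAt_inv_norm_snd hy).const_mul (2 * m)).fun_mul
    ((hn b).fun_mul (hn c))).const_add (-(b.1 * c.1) + inner ℝ b.2 c.2)).fderiv
  simp only [kerrSchild_apply, nullForm_apply, h]
  simp [angularForm]
  rw [real_inner_comm a.2 b.2, real_inner_comm a.2 c.2]
  ring

lemma christoffel_kerrSchild (m : ℝ) (hy : y.2 ≠ 0) (a b c : ℝ × W) :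
    christoffel (kerrSchild m) y a b c = m * ‖y.2‖⁻¹ ^ 2 *
      (2 * angularForm y a b * nullForm y c - radialForm y a * nullForm y b * nullForm y c
        - radialForm y b * nullForm y c * nullForm y a
        + radialForm y c * nullForm y a * nullForm y b) := by
  simp only [christoffel_eq_fderiv, fderiv_kerrSchild_apply m hy, angularForm]
  rw [real_inner_comm a.2 b.2, real_inner_comm b.2 c.2, real_inner_comm a.2 c.2]
  ring

/-- The vector `S_{ab}` with `Γ_{abc} = g(S_{ab}, c)`. -/
noncomputable def kerrSchildChristoffelVector (m : ℝ) (y a b : ℝ × W) : ℝ × W :=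
  (m * ‖y.2‖⁻¹ ^ 2) • ((2 * angularForm y a b - radialForm y a * nullForm y b
      - radialForm y b * nullForm y a - 2 * m * ‖y.2‖⁻¹ * (nullForm y a * nullForm y b)) •
        ((-1, ‖y.2‖⁻¹ • y.2) : ℝ × W)
    + (nullForm y a * nullForm y b) • ((0, ‖y.2‖⁻¹ • y.2) : ℝ × W))

lemma radialForm_self (hy : y.2 ≠ 0) (s : ℝ) : radialForm y (s, ‖y.2‖⁻¹ • y.2) = 1 := by
  have := norm_ne_zero_iff.2 hy
  rw [radialForm_apply, real_inner_smul_right, real_inner_self_eq_norm_sq]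
  field_simp

lemma christoffel_kerrSchild_eq (m : ℝ) (hy : y.2 ≠ 0) (a b w : ℝ × W) :
    christoffel (kerrSchild m) y a b w = kerrSchild m y (kerrSchildChristoffelVector m y a b) w := by
  -- For `s = -1` this says that `(-1, x/r)` represents the null form `dt + dr`; for `s = 0`, that
  -- `(0, x/r)` represents `dr + (2m/r)(dt + dr)`.
  have h1 : ∀ s : ℝ, kerrSchild m y ((s, ‖y.2‖⁻¹ • y.2) : ℝ × W) w =
      -s * w.1 + radialForm y w + 2 * m * ‖y.2‖⁻¹ * ((s + 1) * nullForm y w) := by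
    intro s
    rw [kerrSchild_apply, nullForm_apply y (s, _), radialForm_self hy, real_inner_smul_left,
      ← radialForm_apply]
    simp
  simp only [christoffel_kerrSchild m hy, kerrSchildChristoffelVector, map_smul, map_add,
    add_apply, smul_apply, h1, smul_eq_mul, nullForm_apply y w]
  ring

lemma contraction_christoffel_kerrSchild (m : ℝ) (hy : y.2 ≠ 0) (a b c d : ℝ × W) :
    contraction (kerrSchild m y) (christoffel (kerrSchild m) y a b)
      (christoffel (kerrSchild m) y c d) = m ^ 2 * ‖y.2‖⁻¹ ^ 4 *
      ((2 * angularForm y a b - radialForm y a * nullForm y b - radialForm y b * nullForm y a)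
          * (nullForm y c * nullForm y d)
        + (2 * angularForm y c d - radialForm y c * nullForm y d - radialForm y d * nullForm y c)
          * (nullForm y a * nullForm y b)
        + (1 - 2 * m * ‖y.2‖⁻¹) * (nullForm y a * nullForm y b) * (nullForm y c * nullForm y d)) := by
  rw [contraction_eq (kerrSchild_symm m y) (christoffel_kerrSchild_eq m hy a b)
    (christoffel_kerrSchild_eq m hy c d), ← christoffel_kerrSchild_eq m hy,
    christoffel_kerrSchild m hy]
  -- `Γ_{cd}` sees its last slot only through `dr` and the null form, so these two values on the
  -- spanning vectors suffice. In particular the null form vanishes on `(-1, x/r)`.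
  have h1 : ∀ s : ℝ, nullForm y ((s, ‖y.2‖⁻¹ • y.2) : ℝ × W) = s + 1 := fun s => by
    rw [nullForm_apply, radialForm_self hy]
  simp only [kerrSchildChristoffelVector, map_smul, map_add, smul_eq_mul, h1, radialForm_self hy]
  ring

/-- The curvature of the Schwarzschild metric, in terms of the decomposition of the metric into its
angular part `angularForm` and its radial part. -/
theorem riemann_kerrSchild (m : ℝ) (hy : y.2 ≠ 0) (a b c d : ℝ × W) :
    riemann (kerrSchild m) y a b c d = -m * ‖y.2‖⁻¹ ^ 3 *
      (kulkarniNomizu (angularForm y) (angularForm y) a b c d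
        + kulkarniNomizu (fun u v => kerrSchild m y u v - angularForm y u v)
            (fun u v => kerrSchild m y u v - angularForm y u v) a b c d
        - kulkarniNomizu (fun u v => kerrSchild m y u v - angularForm y u v)
            (angularForm y) a b c d) := by
  have hev : ∀ b c d, (fun y => christoffel (kerrSchild m) y b c d) =ᶠ[nhds y] fun y : ℝ × W =>
      m * (‖y.2‖⁻¹ * ‖y.2‖⁻¹) *
      (2 * (inner ℝ b.2 c.2 - radialForm y b * radialForm y c) * (d.1 + radialForm y d)
        - radialForm y b * (c.1 + radialForm y c) * (d.1 + radialForm y d)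
        - radialForm y c * (d.1 + radialForm y d) * (b.1 + radialForm y b)
        + radialForm y d * (b.1 + radialForm y b) * (c.1 + radialForm y c)) := by
    intro b c d
    filter_upwards [continuous_snd.continuousAt.eventually_ne hy] with z hz
    rw [christoffel_kerrSchild m hz]
    simp only [angularForm, nullForm_apply, sq]
  have hn := fun b => hasFDerivAt_radialForm_apply hy b
  have hl := fun b => (hasFDerivAt_radialForm_apply hy b).const_add (b : ℝ × W).1
  have hΓ := fun b c d => (((hasFDerivAt_inv_norm_snd hy).fun_mul (hasFDerivAt_inv_norm_snd hy)).const_mul m).fun_mul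
    (((((((hn b).fun_mul (hn c)).const_sub (inner ℝ b.2 c.2)).const_mul 2).fun_mul (hl d)).fun_sub
      (((hn b).fun_mul (hl c)).fun_mul (hl d))).fun_sub
      (((hn c).fun_mul (hl d)).fun_mul (hl b)) |>.fun_add
      (((hn d).fun_mul (hl b)).fun_mul (hl c)))
  simp only [riemann, contraction_christoffel_kerrSchild m hy, (hev _ _ _).fderiv_eq,
    (hΓ _ _ _).fderiv, kulkarniNomizu, angularForm, kerrSchild_apply, nullForm_apply]
  simp only [smul_apply, add_apply, sub_apply, neg_apply, smul_eq_mul, 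
    ContinuousLinearMap.comp_apply, ContinuousLinearMap.coe_snd', innerSL_apply_apply]
  rw [real_inner_comm a.2 d.2, real_inner_comm a.2 c.2, real_inner_comm a.2 b.2, real_inner_comm b.2 c.2,
    real_inner_comm b.2 d.2]
  -- Both sides are polynomials in `m`, `1/r`, the time components, the values of `dr` and the inner
  -- products, and they agree with no relation among these.
  ring

end KerrSchild

/-! ### Local coordinates `τ`, `ξ`, `n`, the conformal metric and a smooth frame. -/

section PolarDomain

set_option maxSynthPendingDepth 3

variable {E : Type*} [NormedAddCommGroup E] [NormedSpace ℝ E]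

/-- The `1`-form `4ξ dτ + τ dξ = τ⁻³ dt`. -/
noncomputable def timeForm (τ ξ : E → ℝ) (x : E) : E →L[ℝ] ℝ :=
  (4 * ξ x) • fderiv ℝ τ x + τ x • fderiv ℝ ξ x

/-- The metric `-4 / (2m - τ²) dτ² + (2m - τ²) (4ξ dτ + τ dξ)² + dσ²`, conformal to the Schwarzschild
metric with factor `τ⁴`. -/
noncomputable def conformalMetric (m : ℝ) (τ ξ : E → ℝ) (n : E → EuclideanSpace ℝ (Fin 3)) (x : E) :
    E →L[ℝ] E →L[ℝ] ℝ :=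
  -(4 / (2 * m - τ x ^ 2)) • (fderiv ℝ τ x).smulRight (fderiv ℝ τ x)
    + (2 * m - τ x ^ 2) • (timeForm τ ξ x).smulRight (timeForm τ ξ x)
    + ((ContinuousLinearMap.precomp ℝ (fderiv ℝ n x)).comp
        ((innerSL ℝ).comp (fderiv ℝ n x)) : E →L[ℝ] E →L[ℝ] ℝ)

/-- Functions `τ`, `ξ` and a map `n` to the unit sphere which form a local coordinate system on an
open set `U` disjoint from the horizon `τ² = 2m`. -/
structure IsPolarDomain (m : ℝ) (U : Set E) (τ ξ : E → ℝ) (n : E → EuclideanSpace ℝ (Fin 3)) :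
    Prop where
  isOpen : IsOpen U
  contDiffOn_tau : ContDiffOn ℝ ∞ τ U
  contDiffOn_xi : ContDiffOn ℝ ∞ ξ U
  contDiffOn_sph : ContDiffOn ℝ ∞ n U
  norm_sph : ∀ x ∈ U, ‖n x‖ = 1
  ne_horizon : ∀ x ∈ U, 2 * m - τ x ^ 2 ≠ 0
  eq_zero : ∀ x ∈ U, ∀ v, fderiv ℝ τ x v = 0 → fderiv ℝ ξ x v = 0 → fderiv ℝ n x v = 0 → v = 0
  finrank_eq : finrank ℝ E = 4

/-- The isomorphism `v ↦ (dξ v, dτ v n + dn v)`, the differential of the coordinates `ξ` and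
`exp τ n`, up to a factor. -/
noncomputable def polarFrameMap (τ ξ : E → ℝ) (n : E → EuclideanSpace ℝ (Fin 3)) (x : E) :
    E →L[ℝ] ℝ × EuclideanSpace ℝ (Fin 3) :=
  (fderiv ℝ ξ x).prod ((fderiv ℝ τ x).smulRight (n x) + fderiv ℝ n x)

/-- The coordinate vector field `∂_ξ`. -/
noncomputable def xiField (τ ξ : E → ℝ) (n : E → EuclideanSpace ℝ (Fin 3)) (x : E) : E :=
  (polarFrameMap τ ξ n x).inverse (1, 0)

/-- The coordinate vector field `∂_τ`. -/
noncomputable def tauField (τ ξ : E → ℝ) (n : E → EuclideanSpace ℝ (Fin 3)) (x : E) : E :=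
  (polarFrameMap τ ξ n x).inverse (0, n x)

/-- The vector field tangent to the spheres that projects to the gradient of the `j`-th coordinate
function of the unit sphere. -/
noncomputable def sphField (τ ξ : E → ℝ) (n : E → EuclideanSpace ℝ (Fin 3)) (j : Fin 3) (x : E) :
    E :=
  (polarFrameMap τ ξ n x).inverse (0, EuclideanSpace.single j 1 - n x j • n x)

variable {m : ℝ} {U : Set E} {τ ξ : E → ℝ} {n : E → EuclideanSpace ℝ (Fin 3)}

lemma conformalMetric_apply (x u v : E) : conformalMetric m τ ξ n x u v =
    -(4 / (2 * m - τ x ^ 2)) * (fderiv ℝ τ x u * fderiv ℝ τ x v)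
      + (2 * m - τ x ^ 2) * (timeForm τ ξ x u * timeForm τ ξ x v)
      + inner ℝ (fderiv ℝ n x u) (fderiv ℝ n x v) := by
  simp [conformalMetric]

lemma timeForm_apply (x u : E) :
    timeForm τ ξ x u = 4 * ξ x * fderiv ℝ τ x u + τ x * fderiv ℝ ξ x u := by
  simp [timeForm]

lemma conformalMetric_symm (x u v : E) :
    conformalMetric m τ ξ n x u v = conformalMetric m τ ξ n x v u := by
  rw [conformalMetric_apply, conformalMetric_apply, real_inner_comm]; ring

/-- The condition `k + 1 ≤ k` lets a derivative be taken without loss; it covers both `∞` and `ω`,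
so the same proof serves smoothness and analyticity. -/
lemma contDiffOn_conformalMetric {k : WithTop ℕ∞} (hk : k + 1 ≤ k) (hU : IsOpen U)
    (hτ : ContDiffOn ℝ k τ U) (hξ : ContDiffOn ℝ k ξ U) (hn : ContDiffOn ℝ k n U)
    (hq : ∀ x ∈ U, 2 * m - τ x ^ 2 ≠ 0) : ContDiffOn ℝ k (conformalMetric m τ ξ n) U := by
  have hτ' := hτ.fderiv_of_isOpen hU hk
  have hξ' := hξ.fderiv_of_isOpen hU hk
  have hn' := hn.fderiv_of_isOpen hU hk
  have hq' : ContDiffOn ℝ k (fun x => 2 * m - τ x ^ 2) U := contDiffOn_const.sub (hτ.pow 2)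
  have hω : ContDiffOn ℝ k (timeForm τ ξ) U :=
    ((contDiffOn_const.mul hξ).fun_smul hτ').add (hτ.fun_smul hξ')
  have h1 : ContDiffOn ℝ k (fun x => (innerSL ℝ).comp (fderiv ℝ n x)) U :=
    contDiffOn_const.clm_comp hn'
  have h2 : ContDiffOn ℝ k (fun x =>
      (ContinuousLinearMap.precomp ℝ (fderiv ℝ n x) :
        (EuclideanSpace ℝ (Fin 3) →L[ℝ] ℝ) →L[ℝ] E →L[ℝ] ℝ)) U :=
    ((ContinuousLinearMap.compL ℝ E (EuclideanSpace ℝ (Fin 3)) ℝ).flip.contDiff.comp_contDiffOn hn')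
  unfold conformalMetric
  exact (((contDiffOn_const.div hq' hq).neg.fun_smul (hτ'.smulRight hτ')).add
    (hq'.fun_smul (hω.smulRight hω))).add (h2.clm_comp h1)

namespace IsPolarDomain

variable (hD : IsPolarDomain m U τ ξ n) {x : E} (hx : x ∈ U)

include hD hx

lemma contDiffAt_tau : ContDiffAt ℝ ∞ τ x := hD.contDiffOn_tau.contDiffAt (hD.isOpen.mem_nhds hx)

lemma contDiffAt_xi : ContDiffAt ℝ ∞ ξ x := hD.contDiffOn_xi.contDiffAt (hD.isOpen.mem_nhds hx)

lemma contDiffAt_sph : ContDiffAt ℝ ∞ n x := hD.contDiffOn_sph.contDiffAt (hD.isOpen.mem_nhds hx)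

lemma inner_self_sph : inner ℝ (n x) (n x) = (1 : ℝ) := by
  rw [real_inner_self_eq_norm_sq, hD.norm_sph x hx, one_pow]

lemma inner_sph_fderiv (v : E) : inner ℝ (n x) (fderiv ℝ n x v) = (0 : ℝ) := by
  have hn := ((hD.contDiffAt_sph hx).differentiableAt (by simp)).hasFDerivAt
  have h2 : (fun y => inner ℝ (n y) (n y)) =ᶠ[nhds x] fun _ => (1 : ℝ) := by
    filter_upwards [hD.isOpen.mem_nhds hx] with y hy using hD.inner_self_sph hy
  have h3 := congrArg (· v) ((hn.inner ℝ hn).fderiv.symm.trans h2.fderiv_eq)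
  simp [real_inner_comm] at h3
  linarith

/-- Since `dn v` is orthogonal to `n`, pairing the second component with `n` isolates `dτ v`; the
remainder is `dn v`. -/
lemma polarFrameMap_eq_zero {v : E} (hv : polarFrameMap τ ξ n x v = 0) : v = 0 := by
  simp only [polarFrameMap, ContinuousLinearMap.prod_apply, Prod.mk_eq_zero, add_apply,
    ContinuousLinearMap.smulRight_apply] at hv
  have h1 := congrArg (fun z => inner ℝ (n x) z) hv.2
  simp only [inner_add_right, real_inner_smul_right, hD.inner_self_sph hx,
    hD.inner_sph_fderiv hx, inner_zero_right, mul_one, add_zero] at h1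
  have h2 := hv.2
  rw [h1, zero_smul, zero_add] at h2
  exact hD.eq_zero x hx v h1 hv.1 h2

variable [FiniteDimensional ℝ E]

lemma isInvertible_polarFrameMap : (polarFrameMap τ ξ n x).IsInvertible := by
  have hinj : Function.Injective (polarFrameMap τ ξ n x).toLinearMap :=
    (injective_iff_map_eq_zero _).2 fun v hv => hD.polarFrameMap_eq_zero hx hv
  have hdim : finrank ℝ E = finrank ℝ (ℝ × EuclideanSpace ℝ (Fin 3)) := by
    rw [hD.finrank_eq]; simp
  exact ⟨(LinearEquiv.ofInjectiveOfFinrankEq _ hinj hdim).toContinuousLinearEquiv, by ext <;> rfl⟩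

lemma polarFrameMap_inverse (p : ℝ × EuclideanSpace ℝ (Fin 3)) :
    fderiv ℝ ξ x ((polarFrameMap τ ξ n x).inverse p) = p.1 ∧
    fderiv ℝ τ x ((polarFrameMap τ ξ n x).inverse p) = inner ℝ (n x) p.2 ∧
    fderiv ℝ n x ((polarFrameMap τ ξ n x).inverse p) = p.2 - inner ℝ (n x) p.2 • n x := by
  obtain ⟨e, he⟩ := hD.isInvertible_polarFrameMap hx
  have h : polarFrameMap τ ξ n x ((polarFrameMap τ ξ n x).inverse p) = p := by
    rw [← he, ContinuousLinearMap.inverse_equiv]; exact e.apply_symm_apply p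
  generalize (polarFrameMap τ ξ n x).inverse p = v at h
  have h1 := congrArg Prod.fst h
  have h2 := congrArg Prod.snd h
  simp only [polarFrameMap, ContinuousLinearMap.prod_apply, add_apply,
    ContinuousLinearMap.smulRight_apply] at h1 h2
  have h3 : fderiv ℝ τ x v = inner ℝ (n x) p.2 := by
    rw [← h2, inner_add_right, real_inner_smul_right, hD.inner_self_sph hx,
      hD.inner_sph_fderiv hx, mul_one, add_zero]
  exact ⟨h1, h3, by rw [← h3, ← h2, add_sub_cancel_left]⟩

/-- Inversion of operators is smooth at invertible ones, so the frame fields are smooth although no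
formula for them in the chart is available. -/
lemma contDiffAt_polarFrameMap_inverse :
    ContDiffAt ℝ ∞ (fun x => (polarFrameMap τ ξ n x).inverse) x := by
  have : CompleteSpace E := FiniteDimensional.complete ℝ E
  have h1 : ContDiffAt ℝ ∞ (fderiv ℝ ξ) x := (hD.contDiffAt_xi hx).fderiv_right le_rfl
  have h2 : ContDiffAt ℝ ∞ (fderiv ℝ τ) x := (hD.contDiffAt_tau hx).fderiv_right le_rfl
  have h3 : ContDiffAt ℝ ∞ (fderiv ℝ n) x := (hD.contDiffAt_sph hx).fderiv_right le_rfl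
  have h4 : ContDiffAt ℝ ∞ (polarFrameMap τ ξ n) x :=
    (ContinuousLinearMap.prodₗᵢ (𝕜 := ℝ) (E := E) (F := ℝ) (G := EuclideanSpace ℝ (Fin 3))
      ℝ).contDiff.contDiffAt.comp x (h1.prodMk ((h2.smulRight (hD.contDiffAt_sph hx)).add h3))
  exact ((hD.isInvertible_polarFrameMap hx).contDiffAt_map_inverse).comp x h4

lemma contDiffAt_xiField : ContDiffAt ℝ ∞ (xiField τ ξ n) x :=
  (hD.contDiffAt_polarFrameMap_inverse hx).clm_apply contDiffAt_const

lemma contDiffAt_tauField : ContDiffAt ℝ ∞ (tauField τ ξ n) x :=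
  (hD.contDiffAt_polarFrameMap_inverse hx).clm_apply
    (contDiffAt_const.prodMk (hD.contDiffAt_sph hx))

lemma contDiffAt_sphField (j : Fin 3) : ContDiffAt ℝ ∞ (sphField τ ξ n j) x := by
  have hj : ContDiffAt ℝ ∞ (fun x => n x j) x := (contDiffAt_euclidean.1 (hD.contDiffAt_sph hx)) j
  exact (hD.contDiffAt_polarFrameMap_inverse hx).clm_apply (contDiffAt_const.prodMk
    (contDiffAt_const.sub (hj.smul (hD.contDiffAt_sph hx))))

lemma fderiv_xiField : fderiv ℝ ξ x (xiField τ ξ n x) = 1 ∧ fderiv ℝ τ x (xiField τ ξ n x) = 0 ∧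
    fderiv ℝ n x (xiField τ ξ n x) = 0 := by
  simpa [xiField] using! hD.polarFrameMap_inverse hx (1, 0)

lemma fderiv_tauField : fderiv ℝ ξ x (tauField τ ξ n x) = 0 ∧ fderiv ℝ τ x (tauField τ ξ n x) = 1 ∧
    fderiv ℝ n x (tauField τ ξ n x) = 0 := by
  have h := hD.polarFrameMap_inverse hx (0, n x)
  rwa [hD.inner_self_sph hx, one_smul, sub_self] at h

lemma fderiv_sphField (j : Fin 3) : fderiv ℝ ξ x (sphField τ ξ n j x) = 0 ∧
    fderiv ℝ τ x (sphField τ ξ n j x) = 0 ∧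
    fderiv ℝ n x (sphField τ ξ n j x) = EuclideanSpace.single j 1 - n x j • n x := by
  have h := hD.polarFrameMap_inverse hx (0, EuclideanSpace.single j 1 - n x j • n x)
  have h2 : inner ℝ (n x) (EuclideanSpace.single j 1 - n x j • n x) = (0 : ℝ) := by
    rw [inner_sub_right, real_inner_smul_right, hD.inner_self_sph hx]
    simp [EuclideanSpace.inner_single_right]
  rwa [h2, zero_smul, sub_zero] at h

lemma conformalMetric_xiField (v : E) : conformalMetric m τ ξ n x v (xiField τ ξ n x) =
    (2 * m - τ x ^ 2) * τ x * timeForm τ ξ x v := by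
  obtain ⟨h1, h2, h3⟩ := hD.fderiv_xiField hx
  rw [conformalMetric_apply, timeForm_apply x (xiField τ ξ n x), h1, h2, h3, inner_zero_right]
  ring

lemma conformalMetric_tauField (v : E) : conformalMetric m τ ξ n x v (tauField τ ξ n x) =
    -(4 / (2 * m - τ x ^ 2)) * fderiv ℝ τ x v
      + (2 * m - τ x ^ 2) * (4 * ξ x) * timeForm τ ξ x v := by
  obtain ⟨h1, h2, h3⟩ := hD.fderiv_tauField hx
  rw [conformalMetric_apply, timeForm_apply x (tauField τ ξ n x), h1, h2, h3, inner_zero_right]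
  ring

lemma conformalMetric_sphField (j : Fin 3) (v : E) :
    conformalMetric m τ ξ n x v (sphField τ ξ n j x) = fderiv ℝ n x v j := by
  obtain ⟨h1, h2, h3⟩ := hD.fderiv_sphField hx j
  rw [conformalMetric_apply, timeForm_apply x (sphField τ ξ n j x), h1, h2, h3, inner_sub_right,
    real_inner_smul_right, real_inner_comm (n x), hD.inner_sph_fderiv hx]
  simp [EuclideanSpace.inner_single_right]

/-- The inverse of the metric, multiplied by `τ²` to make it smooth. -/
lemma conformalMetric_eq_sum (u v : E) :
    τ x ^ 2 * conformalMetric m τ ξ n x u v =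
      -((2 * m - τ x ^ 2) / 4) *
        ((τ x * conformalMetric m τ ξ n x u (tauField τ ξ n x)
            - 4 * ξ x * conformalMetric m τ ξ n x u (xiField τ ξ n x)) *
          (τ x * conformalMetric m τ ξ n x v (tauField τ ξ n x)
            - 4 * ξ x * conformalMetric m τ ξ n x v (xiField τ ξ n x)))
      + (2 * m - τ x ^ 2)⁻¹ * (conformalMetric m τ ξ n x u (xiField τ ξ n x) *
          conformalMetric m τ ξ n x v (xiField τ ξ n x))
      + τ x ^ 2 * ∑ j, conformalMetric m τ ξ n x u (sphField τ ξ n j x) *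
          conformalMetric m τ ξ n x v (sphField τ ξ n j x) := by
  have hq := hD.ne_horizon x hx
  -- The time form kills `τ∂_τ - 4ξ∂_ξ` and `dτ` kills `∂_ξ`, so these two fields diagonalize the
  -- radial block. The three gradients of the coordinate functions recover the inner product of `ℝ³`
  -- on the sphere, with no choice of a frame of `S²`.
  simp only [hD.conformalMetric_sphField hx, hD.conformalMetric_tauField hx,
    hD.conformalMetric_xiField hx]
  rw [conformalMetric_apply]
  have h1 : inner ℝ (fderiv ℝ n x u) (fderiv ℝ n x v) =
      ∑ j, fderiv ℝ n x u j * fderiv ℝ n x v j := by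
    simp [PiLp.inner_apply, mul_comm]
  rw [h1]
  field_simp
  ring

lemma isNondegenerateForm_conformalMetric (hτ : τ x ≠ 0) :
    IsNondegenerateForm (conformalMetric m τ ξ n x) := by
  intro u hu
  have hq := hD.ne_horizon x hx
  have h1 := hD.conformalMetric_xiField hx u
  have h2 := hD.conformalMetric_tauField hx u
  have h3 := fun j => hD.conformalMetric_sphField hx j u
  simp only [hu] at h1 h2 h3
  have hω : timeForm τ ξ x u = 0 := by
    simpa [hq, hτ] using h1.symm
  have h4 : fderiv ℝ τ x u = 0 := by
    rw [hω] at h2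
    simpa [hq] using h2.symm
  have h5 : fderiv ℝ ξ x u = 0 := by
    rw [timeForm_apply, h4] at hω
    simpa [hτ] using hω
  refine hD.eq_zero x hx u h4 h5 ?_
  ext j
  rw [← h3 j]; rfl

end IsPolarDomain

end PolarDomain

/-! ### Semi-regularity: the Koszul forms of `τ⁴ h` and their contractions. -/

section SemiRegular

set_option maxSynthPendingDepth 3

variable {E : Type*} [NormedAddCommGroup E] [NormedSpace ℝ E]

lemma IsNondegenerateForm.inFlat [FiniteDimensional ℝ E] {B : E →L[ℝ] E →L[ℝ] ℝ}
    (hB : IsNondegenerateForm B) (φ : E →L[ℝ] ℝ) : InFlat B φ := by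
  let L : E →ₗ[ℝ] Module.Dual ℝ E := B.toLinearMap₁₂
  have hL : Function.Injective L := by
    refine (injective_iff_map_eq_zero L).2 fun u hu => hB u fun v => ?_
    exact congrArg (fun f : Module.Dual ℝ E => f v) hu
  obtain ⟨v, hv⟩ := (LinearMap.injective_iff_surjective_of_finrank_eq_finrank
    Subspace.dual_finrank_eq.symm).1 hL φ.toLinearMap
  exact ⟨v, fun w => (congrArg (fun f : Module.Dual ℝ E => f w) hv).symm⟩

/-- The quotient by `τ³` of the Koszul form of the metric `τ⁴ h`, for `h = conformalMetric m τ ξ n`. -/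
noncomputable def koszulQuotient (m : ℝ) (τ ξ : E → ℝ) (n : E → EuclideanSpace ℝ (Fin 3))
    (X Y : E → E) (x w : E) : ℝ :=
  2 * (fderiv ℝ τ x (X x) * conformalMetric m τ ξ n x (Y x) w
      + fderiv ℝ τ x (Y x) * conformalMetric m τ ξ n x (X x) w
      - fderiv ℝ τ x w * conformalMetric m τ ξ n x (X x) (Y x))
    + τ x * (1 / 2 * (fderiv ℝ (conformalMetric m τ ξ n) x (X x) (Y x) w
      + fderiv ℝ (conformalMetric m τ ξ n) x (Y x) w (X x)
      - fderiv ℝ (conformalMetric m τ ξ n) x w (X x) (Y x))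
      + conformalMetric m τ ξ n x (fderiv ℝ Y x (X x)) w)

namespace IsPolarDomain

variable {m : ℝ} {U : Set E} {τ ξ : E → ℝ} {n : E → EuclideanSpace ℝ (Fin 3)}
  {g : E → E →L[ℝ] E →L[ℝ] ℝ} {X Y Z T : E → E} {x : E}

lemma contDiffAt_conformalMetric (hD : IsPolarDomain m U τ ξ n) (hx : x ∈ U) :
    ContDiffAt ℝ ∞ (conformalMetric m τ ξ n) x :=
  (contDiffOn_conformalMetric le_rfl hD.isOpen hD.contDiffOn_tau hD.contDiffOn_xi
    hD.contDiffOn_sph hD.ne_horizon).contDiffAt (hD.isOpen.mem_nhds hx)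

variable (hD : IsPolarDomain m U τ ξ n) (hg : ∀ y ∈ U, g y = τ y ^ 4 • conformalMetric m τ ξ n y)
  (hx : x ∈ U)

include hD hg hx

omit hD in
lemma metric_symm (u v : E) : g x u v = g x v u := by
  rw [hg x hx]
  exact congrArg (τ x ^ 4 * ·) (conformalMetric_symm x u v)

lemma contDiffAt_metric : ContDiffAt ℝ ∞ g x :=
  (((hD.contDiffAt_tau hx).pow 4).fun_smul (hD.contDiffAt_conformalMetric hx)).congr_of_eventuallyEq
    (Filter.eventuallyEq_of_mem (hD.isOpen.mem_nhds hx) hg)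

lemma fderiv_metric (a b c : E) : fderiv ℝ g x a b c =
    τ x ^ 4 * fderiv ℝ (conformalMetric m τ ξ n) x a b c
      + 4 * τ x ^ 3 * fderiv ℝ τ x a * conformalMetric m τ ξ n x b c := by
  have h1 : HasFDerivAt (fun y => τ y ^ 4) _ x :=
    HasFDerivAt.pow ((hD.contDiffAt_tau hx).differentiableAt (by simp)).hasFDerivAt 4
  have h2 := ((hD.contDiffAt_conformalMetric hx).differentiableAt (by simp)).hasFDerivAt
  rw [(Filter.eventuallyEq_of_mem (hD.isOpen.mem_nhds hx) hg).fderiv_eq, (h1.fun_smul h2).fderiv]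
  simp

lemma koszulForm_eq_mul (hX : DifferentiableAt ℝ X x) (hY : DifferentiableAt ℝ Y x) (w : E) :
    koszulForm g X Y x w = τ x ^ 3 * koszulQuotient m τ ξ n X Y x w := by
  rw [koszulForm_eq ((hD.contDiffAt_metric hg hx).differentiableAt (by simp))
    (metric_symm hg hx) hX hY]
  simp only [hD.fderiv_metric hg hx, hg x hx, smul_apply, smul_eq_mul, koszulQuotient]
  rw [conformalMetric_symm x w (X x)]
  ring

omit hD in
lemma metric_eq_zero (hτ : τ x = 0) (u v : E) : g x u v = 0 := by
  simp [hg x hx, hτ]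

variable [FiniteDimensional ℝ E]

lemma isNondegenerateForm_iff : IsNondegenerateForm (g x) ↔ τ x ≠ 0 := by
  refine ⟨fun h hτ => ?_, fun hτ u hu => ?_⟩
  · have : Nontrivial E := nontrivial_of_finrank_pos (R := ℝ) (by rw [hD.finrank_eq]; norm_num)
    obtain ⟨u, hu⟩ := exists_ne (0 : E)
    exact hu (h u fun v => metric_eq_zero hg hx hτ u v)
  · refine hD.isNondegenerateForm_conformalMetric hx hτ u fun v => ?_
    have := hu v
    rw [hg x hx] at this
    simpa [hτ] using this

lemma koszulForm_inFlat (hX : DifferentiableAt ℝ X x) (hY : DifferentiableAt ℝ Y x) :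
    InFlat (g x) (koszulForm g X Y x) := by
  by_cases hτ : τ x = 0
  · exact ⟨0, fun w => by rw [hD.koszulForm_eq_mul hg hx hX hY, hτ]; simp⟩
  · have h := ((hD.isNondegenerateForm_iff hg hx).2 hτ).inFlat
      ((1 / 2 : ℝ) • (fderiv ℝ g x (X x) (Y x) + (fderiv ℝ g x (Y x)).flip (X x)
        - ((fderiv ℝ g x).flip (X x)).flip (Y x)) + g x (fderiv ℝ Y x (X x)))
    convert h using 1
    ext w
    rw [koszulForm_eq ((hD.contDiffAt_metric hg hx).differentiableAt (by simp))
      (metric_symm hg hx) hX hY]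
    simp

omit hg in
-- At `τ = 0` the vector `∂_ξ` lies in the radical of `h` and in the kernel of `dτ`, and the
-- derivatives of `h` carry a factor `τ`. This makes the contraction formula correct at the
-- singularity.
lemma koszulQuotient_xiField (hτ : τ x = 0) :
    koszulQuotient m τ ξ n X Y x (xiField τ ξ n x) = 0 := by
  simp only [koszulQuotient, hD.conformalMetric_xiField hx, (hD.fderiv_xiField hx).2.1, hτ]
  ring

/-- The right-hand side is the smooth form `τ² h⁻¹` applied to the quotients by `τ³`: the six powers
of `τ` from the two Koszul forms pay for `τ⁻⁴` in the inverse of `g` and for the double pole of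
`h⁻¹`. -/
lemma contraction_koszulForm (hX : DifferentiableAt ℝ X x) (hY : DifferentiableAt ℝ Y x)
    (hZ : DifferentiableAt ℝ Z x) (hT : DifferentiableAt ℝ T x) :
    contraction (g x) (koszulForm g X Y x) (koszulForm g Z T x) =
      -((2 * m - τ x ^ 2) / 4) *
        ((τ x * koszulQuotient m τ ξ n X Y x (tauField τ ξ n x)
            - 4 * ξ x * koszulQuotient m τ ξ n X Y x (xiField τ ξ n x)) *
          (τ x * koszulQuotient m τ ξ n Z T x (tauField τ ξ n x)
            - 4 * ξ x * koszulQuotient m τ ξ n Z T x (xiField τ ξ n x)))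
      + (2 * m - τ x ^ 2)⁻¹ * (koszulQuotient m τ ξ n X Y x (xiField τ ξ n x) *
          koszulQuotient m τ ξ n Z T x (xiField τ ξ n x))
      + τ x ^ 2 * ∑ j, koszulQuotient m τ ξ n X Y x (sphField τ ξ n j x) *
          koszulQuotient m τ ξ n Z T x (sphField τ ξ n j x) := by
  obtain ⟨u, hu⟩ := hD.koszulForm_inFlat hg hx hX hY
  obtain ⟨v, hv⟩ := hD.koszulForm_inFlat hg hx hZ hT
  rw [contraction_eq (metric_symm hg hx) hu hv]
  by_cases hτ : τ x = 0
  -- At the singularity the contraction is `0`, and each summand on the right has a factor `τ` or a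
  -- value of the quotient on `∂_ξ`.
  · rw [metric_eq_zero hg hx hτ]
    simp only [hD.koszulQuotient_xiField hx hτ, hτ]
    ring
  -- A vector `z` representing the Koszul form with respect to `τ⁴ h` represents `K'/τ` with respect
  -- to `h`.
  · have key : ∀ {A B : E → E} {z : E}, DifferentiableAt ℝ A x → DifferentiableAt ℝ B x →
        (∀ w, koszulForm g A B x w = g x z w) →
        ∀ w, koszulQuotient m τ ξ n A B x w = τ x * conformalMetric m τ ξ n x z w := by
      intro A B z hA hB hz w
      have h1 := (hD.koszulForm_eq_mul hg hx hA hB w).symm.trans (hz w)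
      rw [hg x hx] at h1
      refine mul_left_cancel₀ (pow_ne_zero 3 hτ) (h1.trans ?_)
      simp only [smul_apply, smul_eq_mul]
      ring
    simp only [key hX hY hu, key hZ hT hv]
    have h2 := hD.conformalMetric_eq_sum hx u v
    rw [hg x hx]
    simp only [smul_apply, smul_eq_mul, Fin.sum_univ_three] at h2 ⊢
    linear_combination τ x ^ 2 * h2

omit hg hx [FiniteDimensional ℝ E] in
lemma contDiffOn_koszulQuotient {V : Set E} (hV : IsOpen V) (hVU : V ⊆ U) {w : E → E}
    (hX : ContDiffOn ℝ ∞ X V) (hY : ContDiffOn ℝ ∞ Y V) (hw : ContDiffOn ℝ ∞ w V) :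
    ContDiffOn ℝ ∞ (fun x => koszulQuotient m τ ξ n X Y x (w x)) V := by
  have hh : ContDiffOn ℝ ∞ (conformalMetric m τ ξ n) V :=
    fun x hx => (hD.contDiffAt_conformalMetric (hVU hx)).contDiffWithinAt
  have hh' : ContDiffOn ℝ ∞ (fderiv ℝ (conformalMetric m τ ξ n)) V :=
    hh.fderiv_of_isOpen hV le_rfl
  have hτ : ContDiffOn ℝ ∞ τ V := hD.contDiffOn_tau.mono hVU
  have hτ' : ContDiffOn ℝ ∞ (fderiv ℝ τ) V := hτ.fderiv_of_isOpen hV le_rfl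
  have hY' : ContDiffOn ℝ ∞ (fderiv ℝ Y) V := hY.fderiv_of_isOpen hV le_rfl
  have e1 := fun {A B : E → E} (hA : ContDiffOn ℝ ∞ A V) (hB : ContDiffOn ℝ ∞ B V) =>
    (hh.clm_apply hA).clm_apply hB
  have e2 := fun {A B C : E → E} (hA : ContDiffOn ℝ ∞ A V) (hB : ContDiffOn ℝ ∞ B V)
    (hC : ContDiffOn ℝ ∞ C V) => ((hh'.clm_apply hA).clm_apply hB).clm_apply hC
  unfold koszulQuotient
  exact (contDiffOn_const.mul ((((hτ'.clm_apply hX).mul (e1 hY hw)).add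
    ((hτ'.clm_apply hY).mul (e1 hX hw))).sub ((hτ'.clm_apply hw).mul (e1 hX hY)))).add
    (hτ.mul ((contDiffOn_const.mul (((e2 hX hY hw).add (e2 hY hw hX)).sub (e2 hw hX hY))).add
      (e1 (hY'.clm_apply hX) hw)))

omit hx in
lemma contDiffOn_contraction_koszulForm {V : Set E} (hV : IsOpen V) (hVU : V ⊆ U)
    (hX : ContDiffOn ℝ ∞ X V) (hY : ContDiffOn ℝ ∞ Y V) (hZ : ContDiffOn ℝ ∞ Z V)
    (hT : ContDiffOn ℝ ∞ T V) :
    ContDiffOn ℝ ∞ (fun x => contraction (g x) (koszulForm g X Y x) (koszulForm g Z T x)) V := by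
  have hd : ∀ {A : E → E}, ContDiffOn ℝ ∞ A V → ∀ x ∈ V, DifferentiableAt ℝ A x :=
    fun hA x hx => (hA.contDiffAt (hV.mem_nhds hx)).differentiableAt (by simp)
  refine ContDiffOn.congr ?_ fun x hx => hD.contraction_koszulForm hg (hVU hx) (hd hX x hx)
    (hd hY x hx) (hd hZ x hx) (hd hT x hx)
  have hτ : ContDiffOn ℝ ∞ τ V := hD.contDiffOn_tau.mono hVU
  have hξ : ContDiffOn ℝ ∞ ξ V := hD.contDiffOn_xi.mono hVU
  have hq : ContDiffOn ℝ ∞ (fun x => 2 * m - τ x ^ 2) V := contDiffOn_const.sub (hτ.pow 2)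
  have h1 : ContDiffOn ℝ ∞ (xiField τ ξ n) V :=
    fun x hx => (hD.contDiffAt_xiField (hVU hx)).contDiffWithinAt
  have h2 : ContDiffOn ℝ ∞ (tauField τ ξ n) V :=
    fun x hx => (hD.contDiffAt_tauField (hVU hx)).contDiffWithinAt
  have h3 : ∀ j, ContDiffOn ℝ ∞ (sphField τ ξ n j) V :=
    fun j x hx => (hD.contDiffAt_sphField (hVU hx) j).contDiffWithinAt
  have e := fun {A B w : E → E} (hA : ContDiffOn ℝ ∞ A V) (hB : ContDiffOn ℝ ∞ B V)
    (hw : ContDiffOn ℝ ∞ w V) => hD.contDiffOn_koszulQuotient hV hVU hA hB hw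
  have h4 := fun {A B : E → E} (hA : ContDiffOn ℝ ∞ A V) (hB : ContDiffOn ℝ ∞ B V) =>
    (hτ.mul (e hA hB h2)).sub ((contDiffOn_const (c := (4 : ℝ)).mul hξ).mul (e hA hB h1))
  exact (((hq.div_const 4).neg.mul ((h4 hX hY).mul (h4 hZ hT))).add
    ((hq.inv fun x hx => hD.ne_horizon x (hVU hx)).mul ((e hX hY h1).mul (e hZ hT h1)))).add
    ((hτ.pow 2).mul (ContDiffOn.sum fun j _ => (e hX hY (h3 j)).mul (e hZ hT (h3 j))))

omit hx in
lemma contDiffOn_riemann (a b c d : E) : ContDiffOn ℝ ∞ (fun x => riemann g x a b c d) U := by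
  have hgU : ContDiffOn ℝ ∞ g U := fun x hx => (hD.contDiffAt_metric hg hx).contDiffWithinAt
  have hg' : ContDiffOn ℝ ∞ (fderiv ℝ g) U := hgU.fderiv_of_isOpen hD.isOpen le_rfl
  have h1 : ∀ a b c : E, ContDiffOn ℝ ∞ (fun x => fderiv ℝ g x a b c) U := fun a b c =>
    ((hg'.clm_apply contDiffOn_const).clm_apply contDiffOn_const).clm_apply contDiffOn_const
  have h2 : ∀ a b c : E, ContDiffOn ℝ ∞ (fun x => christoffel g x a b c) U := fun a b c =>
    (contDiffOn_const.mul (((h1 a b c).add (h1 b c a)).sub (h1 c a b))).congr fun x hx =>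
      christoffel_eq ((hD.contDiffAt_metric hg hx).differentiableAt (by simp)) a b c
  have h3 : ∀ a b c d : E,
      ContDiffOn ℝ ∞ (fun x => fderiv ℝ (fun y => christoffel g y b c d) x a) U :=
    fun a b c d => ((h2 b c d).fderiv_of_isOpen hD.isOpen le_rfl).clm_apply contDiffOn_const
  -- Christoffel symbols are by definition Koszul forms of constant fields, so the contraction
  -- result applies as it stands.
  have h4 : ∀ a b c d : E, ContDiffOn ℝ ∞ (fun x =>
      contraction (g x) (christoffel g x a b) (christoffel g x c d)) U := fun a b c d =>
    hD.contDiffOn_contraction_koszulForm hg hD.isOpen subset_rfl contDiffOn_const contDiffOn_const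
      contDiffOn_const contDiffOn_const
  exact (((h3 a b c d).sub (h3 b a c d)).add (h4 a c b d)).sub (h4 b c a d)

end IsPolarDomain

end SemiRegular

/-! ### Transport of the curvature to the chart, and Ricci flatness. -/

section VacuumCurvature

set_option maxSynthPendingDepth 3

variable {E : Type*} [NormedAddCommGroup E] [NormedSpace ℝ E]

/-- The Kerr–Schild coordinates `(t + 2m log (r - 2m), r n)`. -/
noncomputable def kerrSchildMap (m : ℝ) (τ ξ : E → ℝ) (n : E → EuclideanSpace ℝ (Fin 3)) (x : E) :
    ℝ × EuclideanSpace ℝ (Fin 3) :=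
  (ξ x * τ x ^ 4 + 2 * m * Real.log (τ x ^ 2 - 2 * m), τ x ^ 2 • n x)

namespace IsPolarDomain

variable {m : ℝ} {U : Set E} {τ ξ : E → ℝ} {n : E → EuclideanSpace ℝ (Fin 3)}
  {g : E → E →L[ℝ] E →L[ℝ] ℝ} {x : E}

variable (hD : IsPolarDomain m U τ ξ n) (hx : x ∈ U)

include hD hx

lemma contDiffAt_kerrSchildMap : ContDiffAt ℝ ∞ (kerrSchildMap m τ ξ n) x := by
  -- `Real.log` is the logarithm of the absolute value, so one formula for the map works on both
  -- sides of the horizon; only `τ² ≠ 2m` is needed.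
  have hτ := hD.contDiffAt_tau hx
  have hq : τ x ^ 2 - 2 * m ≠ 0 := fun h => hD.ne_horizon x hx (by linarith)
  exact (((hD.contDiffAt_xi hx).mul (hτ.pow 4)).add
    (contDiffAt_const.mul (((hτ.pow 2).sub contDiffAt_const).log hq))).prodMk
    ((hτ.pow 2).fun_smul (hD.contDiffAt_sph hx))

lemma fderiv_kerrSchildMap (v : E) : fderiv ℝ (kerrSchildMap m τ ξ n) x v =
    (τ x ^ 3 * timeForm τ ξ x v - 4 * m * τ x / (2 * m - τ x ^ 2) * fderiv ℝ τ x v,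
      (2 * τ x * fderiv ℝ τ x v) • n x + τ x ^ 2 • fderiv ℝ n x v) := by
  have hq := hD.ne_horizon x hx
  have hq' : τ x ^ 2 - 2 * m ≠ 0 := fun h => hq (by linarith)
  have h1 := ((hD.contDiffAt_tau hx).differentiableAt (by simp)).hasFDerivAt
  have h2 := ((hD.contDiffAt_xi hx).differentiableAt (by simp)).hasFDerivAt
  have h3 := ((hD.contDiffAt_sph hx).differentiableAt (by simp)).hasFDerivAt
  have h4 : HasFDerivAt (fun y => τ y ^ 4) _ x := HasFDerivAt.pow h1 4
  have h5 : HasFDerivAt (fun y => τ y ^ 2) _ x := HasFDerivAt.pow h1 2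
  have h6 := ((h2.fun_mul h4).fun_add (((h5.sub_const (2 * m)).log hq').const_mul (2 * m))).prodMk
    (h5.fun_smul h3)
  have h7 : HasFDerivAt (kerrSchildMap m τ ξ n) _ x := h6
  rw [h7.fderiv]
  ext1
  · simp [timeForm_apply]
    rw [show τ x ^ 2 - 2 * m = -(2 * m - τ x ^ 2) by ring]
    field_simp
    ring
  · simp [add_comm]

lemma norm_kerrSchildMap_snd : ‖(kerrSchildMap m τ ξ n x).2‖ = τ x ^ 2 := by
  simp [kerrSchildMap, norm_smul, hD.norm_sph x hx]

section

variable (hτ : τ x ≠ 0)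

include hτ

lemma kerrSchildMap_snd_ne_zero : (kerrSchildMap m τ ξ n x).2 ≠ 0 := by
  rw [← norm_ne_zero_iff, hD.norm_kerrSchildMap_snd hx]; exact pow_ne_zero 2 hτ

lemma radialForm_fderiv_kerrSchildMap (v : E) : radialForm (kerrSchildMap m τ ξ n x)
    (fderiv ℝ (kerrSchildMap m τ ξ n) x v) = 2 * τ x * fderiv ℝ τ x v := by
  rw [radialForm_apply, hD.norm_kerrSchildMap_snd hx, hD.fderiv_kerrSchildMap hx]
  simp only [kerrSchildMap, real_inner_smul_left, inner_add_right, real_inner_smul_right,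
    hD.inner_self_sph hx, hD.inner_sph_fderiv hx]
  field_simp
  ring

omit hτ in
lemma inner_fderiv_kerrSchildMap (u v : E) : inner ℝ (fderiv ℝ (kerrSchildMap m τ ξ n) x u).2
      (fderiv ℝ (kerrSchildMap m τ ξ n) x v).2 =
    4 * τ x ^ 2 * (fderiv ℝ τ x u * fderiv ℝ τ x v)
      + τ x ^ 4 * inner ℝ (fderiv ℝ n x u) (fderiv ℝ n x v) := by
  simp only [hD.fderiv_kerrSchildMap hx, real_inner_smul_left, inner_add_right, inner_add_left,
    real_inner_smul_right, hD.inner_self_sph hx, hD.inner_sph_fderiv hx,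
    real_inner_comm (n x) (fderiv ℝ n x u)]
  ring

lemma angularForm_fderiv_kerrSchildMap (u v : E) : angularForm (kerrSchildMap m τ ξ n x)
      (fderiv ℝ (kerrSchildMap m τ ξ n) x u) (fderiv ℝ (kerrSchildMap m τ ξ n) x v) =
    τ x ^ 4 * inner ℝ (fderiv ℝ n x u) (fderiv ℝ n x v) := by
  rw [angularForm, hD.radialForm_fderiv_kerrSchildMap hx hτ,
    hD.radialForm_fderiv_kerrSchildMap hx hτ, hD.inner_fderiv_kerrSchildMap hx]
  ring

/-- The shift of `t` by `2m log |r - 2m|` is chosen so that the cross terms of `dt` and `dr` in the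
Kerr–Schild form cancel. -/
lemma kerrSchild_fderiv_kerrSchildMap (u v : E) : kerrSchild m (kerrSchildMap m τ ξ n x)
      (fderiv ℝ (kerrSchildMap m τ ξ n) x u) (fderiv ℝ (kerrSchildMap m τ ξ n) x v) =
    τ x ^ 4 * conformalMetric m τ ξ n x u v := by
  have hq := hD.ne_horizon x hx
  rw [kerrSchild_apply, nullForm_apply, nullForm_apply, hD.radialForm_fderiv_kerrSchildMap hx hτ,
    hD.radialForm_fderiv_kerrSchildMap hx hτ, hD.inner_fderiv_kerrSchildMap hx,
    hD.norm_kerrSchildMap_snd hx, conformalMetric_apply, hD.fderiv_kerrSchildMap hx,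
    hD.fderiv_kerrSchildMap hx]
  -- Taking `q = 2m - τ²` as the free variable in place of `m` turns the denominator into an atom.
  obtain ⟨q, hm⟩ : ∃ q, m = (q + τ x ^ 2) / 2 := ⟨2 * m - τ x ^ 2, by ring⟩
  have hq' : 2 * m - τ x ^ 2 = q := by linarith
  rw [hq'] at hq ⊢
  rw [hm]
  field_simp
  ring

/-- Dimensions agree, so injectivity suffices: for a vector in the kernel, `dr` gives `dτ v = 0`,
then the time component gives `dξ v = 0`, and the spatial part gives `dn v = 0`. -/
lemma surjective_fderiv_kerrSchildMap [FiniteDimensional ℝ E] :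
    Function.Surjective (fderiv ℝ (kerrSchildMap m τ ξ n) x) := by
  have hdim : finrank ℝ E = finrank ℝ (ℝ × EuclideanSpace ℝ (Fin 3)) := by
    rw [hD.finrank_eq]; simp
  refine (LinearMap.injective_iff_surjective_of_finrank_eq_finrank
    (f := (fderiv ℝ (kerrSchildMap m τ ξ n) x).toLinearMap) hdim).1
    ((injective_iff_map_eq_zero _).2 fun v hv => ?_)
  have hv' : fderiv ℝ (kerrSchildMap m τ ξ n) x v = 0 := hv
  have h1 := hD.radialForm_fderiv_kerrSchildMap hx hτ v
  rw [hv', map_zero] at h1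
  have h2 : fderiv ℝ τ x v = 0 := by simpa [hτ] using h1.symm
  rw [hD.fderiv_kerrSchildMap hx, h2] at hv'
  have h3 := congrArg Prod.fst hv'
  have h4 := congrArg Prod.snd hv'
  have h5 : fderiv ℝ ξ x v = 0 := by
    simpa [timeForm_apply, h2, hτ] using h3
  exact hD.eq_zero x hx v h2 h5 (by simpa [hτ] using h4)

end

variable (hg : ∀ y ∈ U, g y = τ y ^ 4 • conformalMetric m τ ξ n y) [FiniteDimensional ℝ E]

include hg

/-- The Riemann curvature of the Schwarzschild metric. -/
lemma riemann_eq (hτ : τ x ≠ 0) (a b c d : E) : riemann g x a b c d = -m * (τ x ^ 2)⁻¹ ^ 3 *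
    (kulkarniNomizu (fun u v => τ x ^ 4 * inner ℝ (fderiv ℝ n x u) (fderiv ℝ n x v))
        (fun u v => τ x ^ 4 * inner ℝ (fderiv ℝ n x u) (fderiv ℝ n x v)) a b c d
      + kulkarniNomizu
        (fun u v => g x u v - τ x ^ 4 * inner ℝ (fderiv ℝ n x u) (fderiv ℝ n x v))
        (fun u v => g x u v - τ x ^ 4 * inner ℝ (fderiv ℝ n x u) (fderiv ℝ n x v)) a b c d
      - kulkarniNomizu
        (fun u v => g x u v - τ x ^ 4 * inner ℝ (fderiv ℝ n x u) (fderiv ℝ n x v))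
        (fun u v => τ x ^ 4 * inner ℝ (fderiv ℝ n x u) (fderiv ℝ n x v)) a b c d) := by
  have hF := hD.kerrSchildMap_snd_ne_zero hx hτ
  have hpull : ∀ᶠ y in nhds x, ∀ u v, g y u v = kerrSchild m (kerrSchildMap m τ ξ n y)
      (fderiv ℝ (kerrSchildMap m τ ξ n) y u) (fderiv ℝ (kerrSchildMap m τ ξ n) y v) := by
    filter_upwards [hD.isOpen.mem_nhds hx,
      (hD.contDiffAt_tau hx).continuousAt.eventually_ne hτ] with y hy hτy u v
    rw [hD.kerrSchild_fderiv_kerrSchildMap hy hτy, hg y hy]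
    rfl
  rw [riemann_pullback (contDiffAt_kerrSchild m hF)
    (Filter.Eventually.of_forall (kerrSchild_symm m)) (hD.contDiffAt_kerrSchildMap hx)
    (hD.surjective_fderiv_kerrSchildMap hx hτ) hpull
    (fun a b => ⟨_, christoffel_kerrSchild_eq m hF a b⟩), riemann_kerrSchild m hF,
    hD.norm_kerrSchildMap_snd hx]
  simp only [kulkarniNomizu, hD.angularForm_fderiv_kerrSchildMap hx hτ, ← hpull.self_of_nhds]

/-- The Schwarzschild metric is Ricci flat. -/
lemma ricci_eq_zero (hτ : τ x ≠ 0) (a b : E) : ricci g x a b = 0 := by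
  have hq := hD.ne_horizon x hx
  let f : E → E → ℝ := fun s t => riemann g x a s b t
  -- Bilinearity, required for changing the frame in the trace, is read off from the explicit
  -- curvature formula.
  let T : E →ₗ[ℝ] E →ₗ[ℝ] ℝ := LinearMap.mk₂ ℝ f
    (fun s s' t => by
      simp only [f, hD.riemann_eq hx hg hτ, kulkarniNomizu, map_add, inner_add_left,
        add_apply]
      ring)
    (fun k s t => by
      simp only [f, hD.riemann_eq hx hg hτ, kulkarniNomizu, map_smul, real_inner_smul_left,
        smul_apply, smul_eq_mul]
      ring)
    (fun s t t' => by
      simp only [f, hD.riemann_eq hx hg hτ, kulkarniNomizu, map_add, inner_add_right]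
      ring)
    (fun k s t => by
      simp only [f, hD.riemann_eq hx hg hτ, kulkarniNomizu, map_smul, real_inner_smul_right,
        smul_eq_mul]
      ring)
  -- The frame and weights come from `conformalMetric_eq_sum`; passing from `h` to `τ⁴ h` divides
  -- its coefficients by `τ⁶`.
  let e : Fin 2 ⊕ Fin 3 → E := Sum.elim
    ![τ x • tauField τ ξ n x - (4 * ξ x) • xiField τ ξ n x, xiField τ ξ n x]
    (fun j => sphField τ ξ n j x)
  let c : Fin 2 ⊕ Fin 3 → ℝ := Sum.elim
    ![-((2 * m - τ x ^ 2) / (4 * τ x ^ 6)), (2 * m - τ x ^ 2)⁻¹ * (τ x ^ 6)⁻¹]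
    (fun _ => (τ x ^ 4)⁻¹)
  have hframe : ∀ u v, g x u v = ∑ i, c i * (g x u (e i) * g x v (e i)) := by
    intro u v
    have h := hD.conformalMetric_eq_sum hx u v
    simp only [Fintype.sum_sum_type, c, e, Sum.elim_inl, Sum.elim_inr, Fin.sum_univ_two,
      Matrix.cons_val_zero, Matrix.cons_val_one, hg x hx, smul_apply, smul_eq_mul, map_sub,
      map_smul, Fin.sum_univ_three] at h ⊢
    field_simp at h ⊢
    linear_combination h
  have htr := inverseTrace_eq_sum (metric_symm hg hx)
    ((hD.isNondegenerateForm_iff hg hx).2 hτ) T c e hframe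
  change inverseTrace (g x) f = 0
  rw [show f = fun s t => T s t from rfl, htr]
  obtain ⟨x1, x2, x3⟩ := hD.fderiv_xiField hx
  obtain ⟨t1, t2, t3⟩ := hD.fderiv_tauField hx
  have hs := hD.fderiv_sphField hx
  have hs1 := fun j => (hs j).1
  have hs2 := fun j => (hs j).2.1
  have hs3 : ∀ j v, inner ℝ (fderiv ℝ n x v) (fderiv ℝ n x (sphField τ ξ n j x)) =
      fderiv ℝ n x v j := by
    intro j v
    rw [(hs j).2.2, inner_sub_right, real_inner_smul_right, real_inner_comm (n x),
      hD.inner_sph_fderiv hx]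
    simp [EuclideanSpace.inner_single_right]
  have hs4 : ∀ j v, inner ℝ (fderiv ℝ n x (sphField τ ξ n j x)) (fderiv ℝ n x v) =
      fderiv ℝ n x v j := fun j v => by rw [real_inner_comm, hs3]
  have hs5 : ∀ j, fderiv ℝ n x (sphField τ ξ n j x) j = 1 - n x j ^ 2 := by
    intro j; rw [(hs j).2.2]; simp [sq]
  have hn1 : n x 0 ^ 2 + n x 1 ^ 2 + n x 2 ^ 2 = 1 := by
    have h := hD.inner_self_sph hx
    rw [PiLp.inner_apply, Fin.sum_univ_three] at h
    simpa [sq] using h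
  have hin : inner ℝ (fderiv ℝ n x a) (fderiv ℝ n x b) = fderiv ℝ n x a 0 * fderiv ℝ n x b 0
      + fderiv ℝ n x a 1 * fderiv ℝ n x b 1 + fderiv ℝ n x a 2 * fderiv ℝ n x b 2 := by
    simp [PiLp.inner_apply, Fin.sum_univ_three, mul_comm]
  change ∑ i, c i * riemann g x a (e i) b (e i) = 0
  simp only [hD.riemann_eq hx hg hτ, kulkarniNomizu, hg x hx, smul_apply, smul_eq_mul,
    conformalMetric_apply, timeForm_apply, Fintype.sum_sum_type, c, e, Sum.elim_inl, Sum.elim_inr,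
    Fin.sum_univ_two, Matrix.cons_val_zero, Matrix.cons_val_one, map_sub, map_smul, x1, x2, x3, t1,
    t2, t3, hs1, hs2, hs3, hs4, hs5, Fin.sum_univ_three, inner_zero_left, inner_zero_right, smul_zero,
    sub_zero]
  rw [hin]
  -- The three spherical fields are linearly dependent; `|n|² = 1` is what gives the angular part
  -- trace `∑ (1 - n_j²) = 2`.
  have hn2 : n x 2 ^ 2 = 1 - n x 0 ^ 2 - n x 1 ^ 2 := by linarith
  rw [hn2]
  field_simp
  ring

lemma scalarCurvature_eq_zero (hτ : τ x ≠ 0) : scalarCurvature g x = 0 := by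
  have h : ricci g x = fun _ _ => 0 := by
    ext a b; exact hD.ricci_eq_zero hx hg hτ a b
  simp [scalarCurvature, h, inverseTrace]

lemma tracelessRicci_eq_zero (hτ : τ x ≠ 0) (a b : E) : tracelessRicci g x a b = 0 := by
  rw [tracelessRicci, hD.ricci_eq_zero hx hg hτ, hD.scalarCurvature_eq_zero hx hg hτ]; ring

lemma scalarPart_eq_zero (hτ : τ x ≠ 0) (a b c d : E) : scalarPart g x a b c d = 0 := by
  rw [scalarPart, hD.scalarCurvature_eq_zero hx hg hτ]; ring

lemma semiTracelessPart_eq_zero (hτ : τ x ≠ 0) (a b c d : E) :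
    semiTracelessPart g x a b c d = 0 := by
  simp only [semiTracelessPart, kulkarniNomizu, hD.tracelessRicci_eq_zero hx hg hτ]; ring

lemma riemann_eq_weyl (hτ : τ x ≠ 0) (a b c d : E) :
    riemann g x a b c d = weyl g x a b c d := by
  rw [weyl, hD.scalarPart_eq_zero hx hg hτ, hD.semiTracelessPart_eq_zero hx hg hτ, sub_zero,
    sub_zero]

end IsPolarDomain

end VacuumCurvature

/-! ### Fields of forms and differentials in charts of the maximal atlas. -/

section Charts

variable {E : Type*} [NormedAddCommGroup E] [NormedSpace ℝ E]
  {H : Type*} [TopologicalSpace H] {I : ModelWithCorners ℝ E H} [I.Boundaryless]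
  {M : Type*} [TopologicalSpace M] [ChartedSpace H M]

omit [I.Boundaryless] in
lemma contMDiffOn_extend_symm_target {k : WithTop ℕ∞} {e : OpenPartialHomeomorph M H}
    (he : e ∈ IsManifold.maximalAtlas I k M) :
    ContMDiffOn 𝓘(ℝ, E) I k (e.extend I).symm (e.extend I).target := by
  have h := contMDiffOn_extend_symm he
  rwa [I.image_eq, ← e.extend_target] at h

lemma mdifferentiableAt_extend_symm {e : OpenPartialHomeomorph M H}
    (he : e ∈ IsManifold.maximalAtlas I ∞ M) {x : E} (hx : x ∈ (e.extend I).target) :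
    MDifferentiableAt 𝓘(ℝ, E) I (e.extend I).symm x :=
  ((contMDiffOn_extend_symm_target he).contMDiffAt
    (e.isOpen_extend_target.mem_nhds hx)).mdifferentiableAt (by simp)

lemma injective_mfderiv_extend_symm {e : OpenPartialHomeomorph M H}
    (he : e ∈ IsManifold.maximalAtlas I ∞ M) {x : E} (hx : x ∈ (e.extend I).target) :
    Function.Injective (mfderiv 𝓘(ℝ, E) I (e.extend I).symm x) := by
  have h1 := mdifferentiableAt_extend_symm he hx
  have hs : (e.extend I).symm x ∈ e.source := by
    rw [← e.extend_source (I := I)]; exact (e.extend I).map_target hx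
  have h2 : MDifferentiableAt I 𝓘(ℝ, E) (e.extend I) ((e.extend I).symm x) :=
    (e.contMDiffAt_extend he hs).mdifferentiableAt (by simp)
  have h3 : (e.extend I) ∘ (e.extend I).symm =ᶠ[nhds x] id :=
    Filter.eventuallyEq_of_mem (e.isOpen_extend_target.mem_nhds hx)
      fun y hy => (e.extend I).right_inv hy
  have h4 := (mfderiv_comp x h2 h1).symm.trans h3.mfderiv_eq
  rw [mfderiv_id] at h4
  intro u v huv
  have h5 : ∀ w, mfderiv I 𝓘(ℝ, E) (e.extend I) ((e.extend I).symm x)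
      (mfderiv 𝓘(ℝ, E) I (e.extend I).symm x w) = w := fun w => congrArg (· w) h4
  rw [← h5 u, huv]
  exact h5 v

lemma surjective_mfderiv_extend_symm [FiniteDimensional ℝ E] {e : OpenPartialHomeomorph M H}
    (he : e ∈ IsManifold.maximalAtlas I ∞ M) {x : E} (hx : x ∈ (e.extend I).target) :
    Function.Surjective (mfderiv 𝓘(ℝ, E) I (e.extend I).symm x) := by
  let L : E →L[ℝ] E := mfderiv 𝓘(ℝ, E) I (e.extend I).symm x
  have hL : Function.Injective L.toLinearMap := injective_mfderiv_extend_symm he hx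
  have h := (LinearMap.injective_iff_surjective (f := (L.toLinearMap : E →ₗ[ℝ] E))).1 hL
  exact h

lemma fderiv_comp_extend_symm {F : Type*} [NormedAddCommGroup F] [NormedSpace ℝ F] {f : M → F}
    {e : OpenPartialHomeomorph M H} (he : e ∈ IsManifold.maximalAtlas I ∞ M) {x : E}
    (hx : x ∈ (e.extend I).target) (hf : MDifferentiableAt I 𝓘(ℝ, F) f ((e.extend I).symm x))
    (v : E) : fderiv ℝ (f ∘ (e.extend I).symm) x v =
      mvfderiv I f ((e.extend I).symm x) (mfderiv 𝓘(ℝ, E) I (e.extend I).symm x v) := by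
  rw [← mfderiv_eq_fderiv]
  exact mfderiv_comp_apply x hf (mdifferentiableAt_extend_symm he hx) v

omit [I.Boundaryless] in
lemma chartMetric_apply (g : ∀ p : M, TangentSpace I p →L[ℝ] TangentSpace I p →L[ℝ] ℝ)
    (e : OpenPartialHomeomorph M H) (x u v : E) : chartMetric I g e x u v =
      g ((e.extend I).symm x) (mfderiv 𝓘(ℝ, E) I (e.extend I).symm x u)
        (mfderiv 𝓘(ℝ, E) I (e.extend I).symm x v) := rfl

/-- The inclusion of an open subset of a normed space has the identity as its differential. -/
lemma hasMFDerivAt_opens_val {U : TopologicalSpace.Opens E} (q : U) :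
    HasMFDerivAt 𝓘(ℝ, E) 𝓘(ℝ, E) (Subtype.val : U → E) q (ContinuousLinearMap.id ℝ E) := by
  refine ⟨continuous_subtype_val.continuousAt, ?_⟩
  have h : writtenInExtChartAt 𝓘(ℝ, E) 𝓘(ℝ, E) q (Subtype.val : U → E)
      =ᶠ[nhds (extChartAt 𝓘(ℝ, E) q q)] id :=
    Filter.eventuallyEq_of_mem (extChartAt_target_mem_nhds q) fun z hz =>
      (extChartAt 𝓘(ℝ, E) q).right_inv hz
  exact ((hasFDerivAt_id _).congr_of_eventuallyEq h).hasFDerivWithinAt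

end Charts

/-! ### The Schwarzschild manifold seen in its charts. -/

namespace SchwarzschildManifold

variable {m : ℝ}

lemma hasMFDerivAt_tauXi (p : SchwarzschildManifold m) :
    HasMFDerivAt schwarzschildModel 𝓘(ℝ, ℝ × ℝ)
      (fun q : SchwarzschildManifold m => (q.1 : ℝ × ℝ)) p
      (ContinuousLinearMap.fst ℝ (ℝ × ℝ) (EuclideanSpace ℝ (Fin 2))) :=
  (hasMFDerivAt_opens_val p.1).comp p (hasMFDerivAt_fst p)

lemma hasMFDerivAt_tau (p : SchwarzschildManifold m) :
    HasMFDerivAt schwarzschildModel 𝓘(ℝ, ℝ) (tau (m := m)) p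
      ((ContinuousLinearMap.fst ℝ ℝ ℝ).comp
        (ContinuousLinearMap.fst ℝ (ℝ × ℝ) (EuclideanSpace ℝ (Fin 2)))) :=
  (ContinuousLinearMap.fst ℝ ℝ ℝ).hasMFDerivAt.comp p (hasMFDerivAt_tauXi p)

lemma hasMFDerivAt_xi (p : SchwarzschildManifold m) :
    HasMFDerivAt schwarzschildModel 𝓘(ℝ, ℝ) (xi (m := m)) p
      ((ContinuousLinearMap.snd ℝ ℝ ℝ).comp
        (ContinuousLinearMap.fst ℝ (ℝ × ℝ) (EuclideanSpace ℝ (Fin 2)))) :=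
  (ContinuousLinearMap.snd ℝ ℝ ℝ).hasMFDerivAt.comp p (hasMFDerivAt_tauXi p)

lemma dTau_apply (p : SchwarzschildManifold m) (u : TangentSpace schwarzschildModel p) :
    dTau p u = u.1.1 := by
  have h := (hasMFDerivAt_tau p).mfderiv
  exact congrArg (· u) h

lemma dXi_apply (p : SchwarzschildManifold m) (u : TangentSpace schwarzschildModel p) :
    dXi p u = u.1.2 := by
  have h := (hasMFDerivAt_xi p).mfderiv
  exact congrArg (· u) h

lemma mvfderiv_sphVec_apply (p : SchwarzschildManifold m) (u : TangentSpace schwarzschildModel p) :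
    mvfderiv schwarzschildModel sphVec p u =
      mvfderiv (𝓡 2) ((↑) : UnitSphere → EuclideanSpace ℝ (Fin 3)) p.2 u.2 := by
  have := Fact.mk (@finrank_euclideanSpace_fin ℝ _ (2 + 1))
  have h1 : MDifferentiableAt (𝓡 2) 𝓘(ℝ, EuclideanSpace ℝ (Fin 3))
      ((↑) : UnitSphere → EuclideanSpace ℝ (Fin 3)) p.2 :=
    (contMDiff_coe_sphere (m := 1) p.2).mdifferentiableAt one_ne_zero
  have h2 := (h1.hasMFDerivAt.comp p (hasMFDerivAt_snd (I := 𝓘(ℝ, ℝ × ℝ)) (I' := 𝓡 2) p)).mfderiv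
  exact congrArg (· u) h2

lemma contMDiff_tauXi {k : WithTop ℕ∞} : ContMDiff schwarzschildModel 𝓘(ℝ, ℝ × ℝ) k
    (fun q : SchwarzschildManifold m => (q.1 : ℝ × ℝ)) :=
  ContMDiff.comp (I' := 𝓘(ℝ, ℝ × ℝ)) contMDiff_subtype_val contMDiff_fst

lemma contMDiff_tau {k : WithTop ℕ∞} :
    ContMDiff schwarzschildModel 𝓘(ℝ, ℝ) k (tau (m := m)) :=
  (ContinuousLinearMap.fst ℝ ℝ ℝ).contMDiff.comp contMDiff_tauXi

lemma contMDiff_xi {k : WithTop ℕ∞} :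
    ContMDiff schwarzschildModel 𝓘(ℝ, ℝ) k (xi (m := m)) :=
  (ContinuousLinearMap.snd ℝ ℝ ℝ).contMDiff.comp contMDiff_tauXi

lemma contMDiff_sphVec {k : WithTop ℕ∞} :
    ContMDiff schwarzschildModel 𝓘(ℝ, EuclideanSpace ℝ (Fin 3)) k (sphVec (m := m)) :=
  have := Fact.mk (@finrank_euclideanSpace_fin ℝ _ (2 + 1))
  ContMDiff.comp (I' := 𝓡 2) (contMDiff_coe_sphere (n := 2)) contMDiff_snd

/-- `τ` and `ξ` are coordinates on the first factor, and the inclusion of the sphere in `ℝ³` is an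
immersion. -/
lemma eq_zero_of_differentials (p : SchwarzschildManifold m)
    (u : TangentSpace schwarzschildModel p) (h1 : dTau p u = 0) (h2 : dXi p u = 0)
    (h3 : mvfderiv schwarzschildModel sphVec p u = 0) : u = 0 := by
  have := Fact.mk (@finrank_euclideanSpace_fin ℝ _ (2 + 1))
  rw [dTau_apply] at h1
  rw [dXi_apply] at h2
  rw [mvfderiv_sphVec_apply] at h3
  have h4 : u.2 = 0 := injective_mvfderiv_subtypeVal_sphere (n := 2) p.2 (h3.trans (map_zero _).symm)
  exact Prod.ext (Prod.ext h1 h2) h4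

lemma metric_apply (p : SchwarzschildManifold m) (u v : TangentSpace schwarzschildModel p) :
    metric m p u v = -(4 * tau p ^ 4 / (2 * m - tau p ^ 2)) * (dTau p u * dTau p v)
      + (2 * m - tau p ^ 2) * tau p ^ 4 * ((4 * xi p * dTau p u + tau p * dXi p u)
        * (4 * xi p * dTau p v + tau p * dXi p v))
      + tau p ^ 4 * inner ℝ (mvfderiv schwarzschildModel sphVec p u)
        (mvfderiv schwarzschildModel sphVec p v) := rfl

/-- Together with `chartMetric_eq`, this is the bridge from the manifold to the local theory, for an
arbitrary chart and not only those adapted to the product. -/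
lemma isPolarDomain_chart {e : OpenPartialHomeomorph (SchwarzschildManifold m)
      (ModelProd (ℝ × ℝ) (EuclideanSpace ℝ (Fin 2)))}
    (he : e ∈ IsManifold.maximalAtlas schwarzschildModel ∞ (SchwarzschildManifold m)) :
    IsPolarDomain m (e.extend schwarzschildModel).target
      (tau ∘ (e.extend schwarzschildModel).symm) (xi ∘ (e.extend schwarzschildModel).symm)
      (sphVec ∘ (e.extend schwarzschildModel).symm) where
  isOpen := e.isOpen_extend_target
  contDiffOn_tau := contMDiffOn_iff_contDiffOn.1
    (contMDiff_tau.comp_contMDiffOn (contMDiffOn_extend_symm_target he))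
  contDiffOn_xi := contMDiffOn_iff_contDiffOn.1
    (contMDiff_xi.comp_contMDiffOn (contMDiffOn_extend_symm_target he))
  contDiffOn_sph := contMDiffOn_iff_contDiffOn.1
    (contMDiff_sphVec.comp_contMDiffOn (contMDiffOn_extend_symm_target he))
  norm_sph x _ := norm_eq_of_mem_sphere ((e.extend schwarzschildModel).symm x).2
  ne_horizon x _ := ((e.extend schwarzschildModel).symm x).1.2
  eq_zero x hx v h1 h2 h3 := by
    rw [fderiv_comp_extend_symm he hx (contMDiff_tau.mdifferentiable one_ne_zero _)] at h1
    rw [fderiv_comp_extend_symm he hx (contMDiff_xi.mdifferentiable one_ne_zero _)] at h2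
    rw [fderiv_comp_extend_symm he hx (contMDiff_sphVec.mdifferentiable one_ne_zero _)] at h3
    exact injective_mfderiv_extend_symm he hx
      ((eq_zero_of_differentials _ _ h1 h2 h3).trans (map_zero _).symm)
  finrank_eq := by simp

lemma chartMetric_eq {e : OpenPartialHomeomorph (SchwarzschildManifold m)
      (ModelProd (ℝ × ℝ) (EuclideanSpace ℝ (Fin 2)))}
    (he : e ∈ IsManifold.maximalAtlas schwarzschildModel ∞ (SchwarzschildManifold m)) :
    ∀ x ∈ (e.extend schwarzschildModel).target, chartMetric schwarzschildModel (metric m) e x =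
      (tau ∘ (e.extend schwarzschildModel).symm) x ^ 4 •
        conformalMetric m (tau ∘ (e.extend schwarzschildModel).symm)
          (xi ∘ (e.extend schwarzschildModel).symm)
          (sphVec ∘ (e.extend schwarzschildModel).symm) x := by
  intro x hx
  refine ContinuousLinearMap.ext fun u => ContinuousLinearMap.ext fun v => ?_
  rw [chartMetric_apply, metric_apply, smul_apply, smul_apply, conformalMetric_apply,
    timeForm_apply, timeForm_apply]
  simp only [fderiv_comp_extend_symm he hx (contMDiff_tau.mdifferentiable one_ne_zero _),
    fderiv_comp_extend_symm he hx (contMDiff_xi.mdifferentiable one_ne_zero _),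
    fderiv_comp_extend_symm he hx (contMDiff_sphVec.mdifferentiable one_ne_zero _),
    Function.comp_apply, smul_eq_mul, dTau, dXi]
  ring

lemma isNondegenerateForm_metric {p : SchwarzschildManifold m} (hp : tau p ≠ 0) :
    IsNondegenerateForm (metric m p) := by
  obtain ⟨e, he, hp'⟩ : ∃ e ∈ IsManifold.maximalAtlas schwarzschildModel ∞
      (SchwarzschildManifold m), p ∈ (e.extend schwarzschildModel).source :=
    ⟨chartAt _ p, IsManifold.chart_mem_maximalAtlas p, by
      rw [OpenPartialHomeomorph.extend_source]; exact mem_chart_source _ p⟩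
  obtain ⟨x, hx, rfl⟩ : ∃ x ∈ (e.extend schwarzschildModel).target,
      (e.extend schwarzschildModel).symm x = p :=
    ⟨_, (e.extend schwarzschildModel).map_source hp', (e.extend schwarzschildModel).left_inv hp'⟩
  have hnd := ((isPolarDomain_chart he).isNondegenerateForm_iff (chartMetric_eq he) hx).2 hp
  intro u hu
  obtain ⟨v, rfl⟩ := surjective_mfderiv_extend_symm he hx u
  rw [hnd v fun w => hu _]
  exact map_zero _

lemma dense_nondegenerate : Dense {p : SchwarzschildManifold m | IsNondegenerateForm (metric m p)} := by
  have h1 : Dense {y : ℝ | y ≠ 0} := dense_compl_singleton 0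
  have h2 : Dense (tau (m := m) ⁻¹' {y : ℝ | y ≠ 0}) := by
    -- Preimages of dense sets under open maps are dense, and `τ` is a composition of projections
    -- with the inclusion of an open set.
    refine h1.preimage ?_
    exact isOpenMap_fst.comp (((tauXiDomain m).isOpen.isOpenMap_subtype_val).comp isOpenMap_fst)
  exact h2.mono fun p hp => isNondegenerateForm_metric hp

end SchwarzschildManifold

/-! ### Bounds on the signature from test subspaces. -/

section Signature

variable {V : Type*} [AddCommGroup V] [Module ℝ V] [FiniteDimensional ℝ V]

lemma sigPos_lt_finrank {Q : QuadraticForm ℝ V} {v : V} (hv : v ≠ 0) (hQ : Q v ≤ 0) :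
    sigPos Q + 1 ≤ finrank ℝ V := by
  rw [← finrank_span_singleton (K := ℝ) hv]
  refine QuadraticForm.sigPos_add_finrank_le_of_nonpos fun x hx => ?_
  obtain ⟨c, rfl⟩ := Submodule.mem_span_singleton.1 hx
  rw [QuadraticMap.map_smul]
  exact mul_nonpos_of_nonneg_of_nonpos (mul_self_nonneg c) hQ

/-- A subspace on which `Q` is negative definite meets the kernel of `φ` trivially, and that kernel
has codimension at most one. -/
lemma sigNeg_le_one {Q : QuadraticForm ℝ V} (φ : V →ₗ[ℝ] ℝ) (hQ : ∀ v, φ v = 0 → 0 ≤ Q v) :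
    sigNeg Q ≤ 1 := by
  have h1 : sigPos (-Q) + finrank ℝ (LinearMap.ker φ) ≤ finrank ℝ V :=
    QuadraticForm.sigPos_add_finrank_le_of_nonpos fun x hx => neg_nonpos.2 (hQ x hx)
  have h2 := φ.finrank_range_add_finrank_ker
  have h3 := Submodule.finrank_le (LinearMap.range φ)
  rw [finrank_self] at h3
  rw [sigPos_neg] at h1
  omega

end Signature

/-! ### Signature, line element, analyticity and regularity of the metric. -/

namespace SchwarzschildManifold

set_option maxSynthPendingDepth 3

variable {m : ℝ}

lemma metric_self (p : SchwarzschildManifold m) (u : TangentSpace schwarzschildModel p) :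
    LinearMap.BilinMap.toQuadraticMap (metric m p).toLinearMap₁₂ u =
      -(4 * tau p ^ 4 / (2 * m - tau p ^ 2)) * (dTau p u * dTau p u)
      + (2 * m - tau p ^ 2) * tau p ^ 4 * ((4 * xi p * dTau p u + tau p * dXi p u)
        * (4 * xi p * dTau p u + tau p * dXi p u))
      + tau p ^ 4 * inner ℝ (mvfderiv schwarzschildModel sphVec p u)
        (mvfderiv schwarzschildModel sphVec p u) := rfl

instance (p : SchwarzschildManifold m) : FiniteDimensional ℝ (TangentSpace schwarzschildModel p) :=
  inferInstanceAs (FiniteDimensional ℝ ((ℝ × ℝ) × EuclideanSpace ℝ (Fin 2)))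

lemma finrank_tangentSpace (p : SchwarzschildManifold m) :
    finrank ℝ (TangentSpace schwarzschildModel p) = 4 :=
  (by simp : finrank ℝ ((ℝ × ℝ) × EuclideanSpace ℝ (Fin 2)) = 4)

lemma exists_tangent (p : SchwarzschildManifold m) (w : ℝ × ℝ) :
    ∃ v : TangentSpace schwarzschildModel p, dTau p v = w.1 ∧ dXi p v = w.2 ∧
      mvfderiv schwarzschildModel sphVec p v = 0 :=
  ⟨((w, 0) : (ℝ × ℝ) × EuclideanSpace ℝ (Fin 2)), dTau_apply p _, dXi_apply p _,
    (mvfderiv_sphVec_apply p _).trans (map_zero _)⟩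

lemma sigPos_metric_le (p : SchwarzschildManifold m) :
    sigPos (LinearMap.BilinMap.toQuadraticMap (metric m p).toLinearMap₁₂) ≤ 3 := by
  have key : ∀ w : ℝ × ℝ, w ≠ 0 →
      -(4 * tau p ^ 4 / (2 * m - tau p ^ 2)) * (w.1 * w.1)
      + (2 * m - tau p ^ 2) * tau p ^ 4 * ((4 * xi p * w.1 + tau p * w.2)
        * (4 * xi p * w.1 + tau p * w.2)) ≤ 0 →
      sigPos (LinearMap.BilinMap.toQuadraticMap (metric m p).toLinearMap₁₂) ≤ 3 := by
    intro w hw h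
    obtain ⟨v, h1, h2, h3⟩ := exists_tangent p w
    have h' := sigPos_lt_finrank
      (Q := LinearMap.BilinMap.toQuadraticMap (metric m p).toLinearMap₁₂) (v := v)
      (fun h0 => hw (by
        rw [h0, map_zero] at h1 h2
        exact Prod.ext h1.symm h2.symm)) (by
        rw [metric_self, h1, h2, h3, inner_zero_left, mul_zero, add_zero]
        exact h)
    rw [finrank_tangentSpace] at h'
    exact Nat.le_of_succ_le_succ h'
  -- A nonzero vector with `Q ≤ 0`: any vector at the singularity, where `g = 0`; `∂_ξ` where `r >
  -- 2m`; and `τ∂_τ - 4ξ∂_ξ`, killed by the time form, where `0 < r < 2m`.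
  by_cases hτ : tau p = 0
  · exact key (1, 0) (by simp) (by simp [hτ])
  rcases lt_or_gt_of_ne (p.1.2 : 2 * m - tau p ^ 2 ≠ 0) with hq | hq
  · refine key (0, 1) (by simp) ?_
    have : 0 ≤ tau p ^ 4 * (tau p * tau p) :=
      mul_nonneg (by positivity) (mul_self_nonneg _)
    simp only [mul_zero, zero_add, mul_one]
    rw [mul_assoc]
    exact mul_nonpos_of_nonpos_of_nonneg hq.le this
  · refine key (tau p, -4 * xi p) (fun h => hτ (congrArg Prod.fst h)) ?_
    have h1 : 4 * xi p * tau p + tau p * (-4 * xi p) = 0 := by ring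
    have h2 : 0 ≤ 4 * tau p ^ 4 / (2 * m - tau p ^ 2) * (tau p * tau p) :=
      mul_nonneg (by positivity) (mul_self_nonneg _)
    simp only [h1, mul_zero, add_zero]
    linarith

lemma sigNeg_metric_le (p : SchwarzschildManifold m) :
    sigNeg (LinearMap.BilinMap.toQuadraticMap (metric m p).toLinearMap₁₂) ≤ 1 := by
  have h3 : ∀ u, 0 ≤ tau p ^ 4 * inner ℝ (mvfderiv schwarzschildModel sphVec p u)
      (mvfderiv schwarzschildModel sphVec p u) := fun u =>
    mul_nonneg (by positivity) real_inner_self_nonneg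
  -- The only possibly negative square is that of the time form where `r > 2m`, and that of `dτ`
  -- where `r < 2m`; its kernel is the test subspace.
  rcases lt_or_gt_of_ne (p.1.2 : 2 * m - tau p ^ 2 ≠ 0) with hq | hq
  · refine sigNeg_le_one  (((4 * xi p) • dTau p + tau p • dXi p).toLinearMap) fun v hv => ?_
    have hv' : 4 * xi p * dTau p v + tau p * dXi p v = 0 := hv
    refine le_of_le_of_eq ?_ (metric_self p v).symm
    rw [hv', mul_zero, mul_zero, add_zero]
    refine add_nonneg (mul_nonneg (neg_nonneg.2 ?_) (mul_self_nonneg _)) (h3 v)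
    exact div_nonpos_of_nonneg_of_nonpos (by positivity) hq.le
  · refine sigNeg_le_one  (dTau p).toLinearMap fun v hv => ?_
    have hv' : dTau p v = 0 := hv
    refine le_of_le_of_eq ?_ (metric_self p v).symm
    rw [hv', mul_zero, mul_zero, mul_zero, zero_add, zero_add]
    exact add_nonneg (mul_nonneg (by positivity) (mul_self_nonneg _)) (h3 v)

lemma metric_eq_lineElement {p : SchwarzschildManifold m} (hτ : tau p ≠ 0)
    (u v : TangentSpace schwarzschildModel p) :
    metric m p u v = schwarzschildLineElement schwarzschildModel m
      (fun q : SchwarzschildManifold m => xi q * tau q ^ 4) (fun q => tau q ^ 2) sph p u v := by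
  have hq : 2 * m - tau p ^ 2 ≠ 0 := p.1.2
  have ht : ∀ w : TangentSpace schwarzschildModel p,
      mvfderiv schwarzschildModel (fun q : SchwarzschildManifold m => xi q * tau q ^ 4) p w
        = tau p ^ 4 * dXi p w + 4 * xi p * tau p ^ 3 * dTau p w := by
    intro w
    have h1 : HasFDerivAt (fun y : ℝ × ℝ => y.2 * y.1 ^ 4) _ (tau p, xi p) :=
      (hasFDerivAt_snd (𝕜 := ℝ) (p := (tau p, xi p))).mul
        (HasFDerivAt.pow (hasFDerivAt_fst (𝕜 := ℝ) (p := (tau p, xi p))) 4)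
    have h2 := (h1.hasMFDerivAt.comp p (hasMFDerivAt_tauXi p)).mfderiv
    refine (congrArg (· w) h2).trans ?_
    rw [dXi_apply, dTau_apply]
    change xi p * ((4 • tau p ^ (4 - 1)) * w.1.1) + tau p ^ 4 * w.1.2 = _
    rw [nsmul_eq_mul]
    push_cast
    ring
  have hr : ∀ w : TangentSpace schwarzschildModel p,
      mvfderiv schwarzschildModel (fun q : SchwarzschildManifold m => tau q ^ 2) p w
        = 2 * tau p * dTau p w := by
    intro w
    have h1 : HasFDerivAt (fun y : ℝ × ℝ => y.1 ^ 2) _ (tau p, xi p) :=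
      HasFDerivAt.pow (hasFDerivAt_fst (𝕜 := ℝ) (p := (tau p, xi p))) 2
    have h2 := (h1.hasMFDerivAt.comp p (hasMFDerivAt_tauXi p)).mfderiv
    refine (congrArg (· w) h2).trans ?_
    rw [dTau_apply]
    change (2 • tau p ^ (2 - 1)) * w.1.1 = _
    rw [nsmul_eq_mul]
    push_cast
    ring
  rw [metric_apply, schwarzschildLineElement, ht, ht, hr, hr]
  change _ + tau p ^ 4 * inner ℝ (mvfderiv schwarzschildModel sphVec p u)
        (mvfderiv schwarzschildModel sphVec p v) = _ +
    (tau p ^ 2) ^ 2 * inner ℝ (mvfderiv schwarzschildModel sphVec p u)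
        (mvfderiv schwarzschildModel sphVec p v)
  have h1 : (1 - 2 * m / tau p ^ 2) = -(2 * m - tau p ^ 2) / tau p ^ 2 := by field_simp; ring
  rw [h1]
  field_simp
  ring

lemma analyticOnNhd_chartMetric {e : OpenPartialHomeomorph (SchwarzschildManifold m)
      (ModelProd (ℝ × ℝ) (EuclideanSpace ℝ (Fin 2)))}
    (he : e ∈ IsManifold.maximalAtlas schwarzschildModel ω (SchwarzschildManifold m)) :
    AnalyticOnNhd ℝ (chartMetric schwarzschildModel (metric m) e)
      (e.extend schwarzschildModel).target := by
  have he' : e ∈ IsManifold.maximalAtlas schwarzschildModel ∞ (SchwarzschildManifold m) :=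
    IsManifold.maximalAtlas_subset_of_le le_top he
  have hτ := contMDiffOn_iff_contDiffOn.1
    ((contMDiff_tau (m := m)).comp_contMDiffOn (contMDiffOn_extend_symm_target he))
  have hξ := contMDiffOn_iff_contDiffOn.1
    ((contMDiff_xi (m := m)).comp_contMDiffOn (contMDiffOn_extend_symm_target he))
  have hn := contMDiffOn_iff_contDiffOn.1
    ((contMDiff_sphVec (m := m)).comp_contMDiffOn (contMDiffOn_extend_symm_target he))
  have hD := isPolarDomain_chart he'
  have h := contDiffOn_conformalMetric (by simp) hD.isOpen hτ hξ hn hD.ne_horizon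
  exact hD.isOpen.analyticOn_iff_analyticOnNhd.1
    (ContDiffOn.analyticOn (((hτ.pow 4).fun_smul h).congr (chartMetric_eq he')))

variable (m)

lemma isSemiRegular_metric : IsSemiRegular schwarzschildModel (metric m) where
  symm p u v := by
    rw [metric_apply, metric_apply, real_inner_comm]
    ring
  smooth e he x hx :=
    ((isPolarDomain_chart he).contDiffAt_metric (chartMetric_eq he) hx).contDiffWithinAt
  koszul_inFlat e he V hV hVU X Y hX hY x hx :=
    (isPolarDomain_chart he).koszulForm_inFlat (chartMetric_eq he) (hVU hx)
      ((hX.contDiffAt (hV.mem_nhds hx)).differentiableAt (by simp))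
      ((hY.contDiffAt (hV.mem_nhds hx)).differentiableAt (by simp))
  contraction_smooth e he V hV hVU X Y Z T hX hY hZ hT :=
    (isPolarDomain_chart he).contDiffOn_contraction_koszulForm (chartMetric_eq he) hV hVU hX hY hZ hT

lemma isQuasiRegular_metric : IsQuasiRegular schwarzschildModel (metric m) where
  toIsSemiRegular := isSemiRegular_metric m
  dense_nondegenerate := dense_nondegenerate
  scalarPart_extends e he a b c d := by
    -- The tensor vanishes wherever `g` is non-degenerate, so the extension is zero.
    refine ⟨fun _ => 0, contDiffOn_const, fun x hx h => ?_⟩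
    exact ((isPolarDomain_chart he).scalarPart_eq_zero hx (chartMetric_eq he)
      (((isPolarDomain_chart he).isNondegenerateForm_iff (chartMetric_eq he) hx).1 h) a b c d).symm
  semiTracelessPart_extends e he a b c d := by
    refine ⟨fun _ => 0, contDiffOn_const, fun x hx h => ?_⟩
    exact ((isPolarDomain_chart he).semiTracelessPart_eq_zero hx (chartMetric_eq he)
      (((isPolarDomain_chart he).isNondegenerateForm_iff (chartMetric_eq he) hx).1 h) a b c d).symm

lemma isSemiRegularSpacetime_metric : IsSemiRegularSpacetime schwarzschildModel (metric m) where
  toIsSemiRegular := isSemiRegular_metric m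
  dim_eq := by simp
  sigPos_le := sigPos_metric_le
  sigNeg_le := sigNeg_metric_le
  dense_nondegenerate := dense_nondegenerate

end SchwarzschildManifold

theorem mainTheorem5 (m : ℝ) (hm : 0 < m) :
    -- for `τ ≠ 0`, the metric is the Schwarzschild metric with `r = τ²`, `t = ξτ⁴`
    (∀ p : SchwarzschildManifold m, SchwarzschildManifold.tau p ≠ 0 →
      ∀ u v : TangentSpace schwarzschildModel p,
        SchwarzschildManifold.metric m p u v =
          schwarzschildLineElement schwarzschildModel m
            (fun q : SchwarzschildManifold m =>
              SchwarzschildManifold.xi q * SchwarzschildManifold.tau q ^ 4)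
            (fun q => SchwarzschildManifold.tau q ^ 2) SchwarzschildManifold.sph p u v) ∧
    -- the metric is analytic, also at `τ = 0`
    (∀ e ∈ IsManifold.maximalAtlas schwarzschildModel ω (SchwarzschildManifold m),
      AnalyticOnNhd ℝ (chartMetric schwarzschildModel (SchwarzschildManifold.metric m) e)
        (e.extend schwarzschildModel).target) ∧
    -- quasi-regularity
    IsQuasiRegularSpacetime schwarzschildModel (SchwarzschildManifold.metric m) ∧
    -- in every smooth chart: the curvature where the metric is non-degenerate ...
    (∀ e ∈ IsManifold.maximalAtlas schwarzschildModel ∞ (SchwarzschildManifold m),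
      ∀ x ∈ (e.extend schwarzschildModel).target,
        IsNondegenerateForm
          (chartMetric schwarzschildModel (SchwarzschildManifold.metric m) e x) →
        (∀ a b, ricci (chartMetric schwarzschildModel (SchwarzschildManifold.metric m) e) x a b
          = 0) ∧
        (∀ a b c d, scalarPart
          (chartMetric schwarzschildModel (SchwarzschildManifold.metric m) e) x a b c d = 0) ∧
        (∀ a b c d, semiTracelessPart
          (chartMetric schwarzschildModel (SchwarzschildManifold.metric m) e) x a b c d = 0) ∧
        (∀ a b c d,
          riemann (chartMetric schwarzschildModel (SchwarzschildManifold.metric m) e) x a b c d =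
          weyl (chartMetric schwarzschildModel (SchwarzschildManifold.metric m) e) x a b c d)) ∧
    -- ... and smoothness of `R_{abcd}`, hence of the extension of `C_{abcd}`, everywhere
    (∀ e ∈ IsManifold.maximalAtlas schwarzschildModel ∞ (SchwarzschildManifold m),
      ∀ a b c d, ContDiffOn ℝ ∞
        (fun x =>
          riemann (chartMetric schwarzschildModel (SchwarzschildManifold.metric m) e) x a b c d)
        (e.extend schwarzschildModel).target) := by
  refine ⟨fun p hτ u v => SchwarzschildManifold.metric_eq_lineElement hτ u v,
    fun e he => SchwarzschildManifold.analyticOnNhd_chartMetric he,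
    ⟨SchwarzschildManifold.isQuasiRegular_metric m,
      SchwarzschildManifold.isSemiRegularSpacetime_metric m⟩,
    fun e he x hx h => ?_, fun e he =>
      (SchwarzschildManifold.isPolarDomain_chart he).contDiffOn_riemann
        (SchwarzschildManifold.chartMetric_eq he)⟩
  have hD := SchwarzschildManifold.isPolarDomain_chart he
  have hg := SchwarzschildManifold.chartMetric_eq he
  have hτ := (hD.isNondegenerateForm_iff hg hx).1 h
  exact ⟨hD.ricci_eq_zero hx hg hτ, hD.scalarPart_eq_zero hx hg hτ,
    hD.semiTracelessPart_eq_zero hx hg hτ, hD.riemann_eq_weyl hx hg hτ⟩
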